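/- For integers $n\ge 2$ and $d\ge 1$, let $[n]=\{1,\dots,n\}$. A function $f:[n]^d\to\mathbb R$ is \emph{unate} if for every coordinate $i\in\{1,\dots,d\}$ it is either nondecreasing in the $i$-th coordinate or nonincreasing in the $i$-th coordinate. It is \emph{$\varepsilon$-far from unate} if it differs from every unate function $[n]^d\to\mathbb R$ on at least $\varepsilon n^d$ points. A \emph{nonadaptive unateness tester} with distance parameter $\varepsilon$ is a randomized algorithm that chooses a set of query points in $[n]^d$ depending only on its random seed, receives the values of $f$ at these points, and then, depending on the seed and these values, accepts or rejects; it must accept with probability at least $2/3$ if $f$ is unate, and reject with probability at least $2/3$ if $f$ is $\varepsilon$-far from unate (two-sided error is allowed). Theorem. Any nonadaptive unateness tester for functions $f:[n]^d\to\mathbb R$ with distance parameter $\varepsilon=1/8$ (and hence with any $\varepsilon\in(0,1/8]$) must make $\Omega(d(\log n+\log d))$ queries. That is, there is an absolute constant $c>0$ such that for all integers $n\ge 2$ and $d\ge 1$ with $(n,d)\neq(2,1)$ and every $\varepsilon\in(0,1/8]$, every nonadaptive unateness tester for functions $f:[n]^d\to\mathbb R$ with distance parameter $\varepsilon$ that makes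 at most $q$ queries satisfies $$q\ \ge\ c\cdot d\,(\log n+\log d).$$ -/

import Mathlib

open MeasureTheory

namespace UnatenessTesting

/-- The hypergrid `[n]^d`; the ordered set `[n]` is modelled by `Fin n`. -/
abbrev Grid (n d : ℕ) : Type := Fin d → Fin n

/-- `f : [n]^d → ℝ` is unate if, for every coordinate `i`, it is either nondecreasing in the
`i`-th coordinate or nonincreasing in the `i`-th coordinate. -/
def Unate {n d : ℕ} (f : Grid n d → ℝ) : Prop :=
  ∀ i : Fin d,
    (∀ x : Grid n d, Monotone fun a : Fin n => f (Function.update x i a)) ∨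
    (∀ x : Grid n d, Antitone fun a : Fin n => f (Function.update x i a))

/-- `f` is `ε`-far from unate if at least an `ε` fraction of its values must be modified to make
it unate. -/
def FarFromUnate {n d : ℕ} (ε : ℝ) (f : Grid n d → ℝ) : Prop :=
  ∀ g : Grid n d → ℝ, Unate g → ε * (Fintype.card (Grid n d) : ℝ) ≤ (hammingDist f g : ℝ)

/-- A randomized nonadaptive query algorithm for real-valued functions on `X`, with random seed
in `Ω`. The set of queried points depends on the seed only; the decision (`true` for "accept")
depends on the seed and on the values of the input function at the queried points. -/
structure NonadaptiveAlgorithm (X : Type*) (Ω : Type*) [MeasurableSpace Ω] where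
  /-- The points that are queried. -/
  queries : Ω → Finset X
  /-- The decision taken after seeing the answers. -/
  decision : (ω : Ω) → ({x : X // x ∈ queries ω} → ℝ) → Bool
  measurableSet_queries : ∀ Q : Finset X, MeasurableSet {ω | queries ω = Q}
  measurableSet_decision : ∀ f : X → ℝ, MeasurableSet {ω | decision ω (fun x => f x) = true}

namespace NonadaptiveAlgorithm

variable {X Ω : Type*} [MeasurableSpace Ω]

/-- The output of the algorithm on input `f` and seed `ω`. -/
def output (T : NonadaptiveAlgorithm X Ω) (f : X → ℝ) (ω : Ω) : Bool :=
  T.decision ω fun x => f x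

/-- The algorithm makes at most `q` queries, whatever its seed. -/
def MakesAtMost (T : NonadaptiveAlgorithm X Ω) (q : ℕ) : Prop :=
  ∀ ω, (T.queries ω).card ≤ q

/-- With seed distribution `μ`, the algorithm is a (two-sided error) tester for unateness with
distance parameter `ε`. -/
def IsUnatenessTester {n d : ℕ} (T : NonadaptiveAlgorithm (Grid n d) Ω) (μ : Measure Ω)
    (ε : ℝ) : Prop :=
  (∀ f, Unate f → 2 / 3 ≤ μ.real {ω | T.output f ω = true}) ∧
  (∀ f, FarFromUnate ε f → 2 / 3 ≤ μ.real {ω | T.output f ω = false})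

end NonadaptiveAlgorithm

end UnatenessTesting

/-!
By Yao's principle it suffices to find random unate functions and random functions far from unate
whose restrictions to any fixed set `Q` of few queries have nearly the same distribution.

The values must reveal nothing beyond a few comparisons. All functions below have the form
`f x = W * h x + U (node x) + τ x`, where `node` forgets part of the coordinates, `h` depends on
`node x` only, `U` is uniform in a box `[0, K) ^ V` with `K` huge, `τ` is bounded, and `W` is much
larger than `K`. If on `Q` two choices of `τ` differ by a function of `node`, a translation of `U`
turns one function into the other, at the cost of a boundary effect `O(|V| / K)`
(`card_noisy_le`). So `Q` only learns how `τ` varies between queries with the same node. This is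
`not_isUnatenessTester_of_hidden`.

*The bound `Ω(d log n)`* (`lt_four_mul_of_isUnatenessTester`). Choose a random coordinate `i` and a
random binary digit `j`; let `node` erase the digits `0, …, j` of `x i`, and let `τ` be plus or
minus the `j`-th digit. With the sign plus, `f` is monotone. With the sign minus, `f` is far from
monotone and from antitone along `i`. To see the difference, `Q` must contain two points that
differ in the `j`-th digit of `x i`, but in no higher digit and in no other coordinate. Refining a
partition of `Q` digit by digit shows that this happens for at most `q` pairs `(i, j)`
(`card_branching_add_card_image_le`, `card_separated_bits_le`).

*The bound `Ω(d log d)`* (`lt_mul_of_isUnatenessTester`). Split the coordinates into `D` ordinary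
ones and `t` selecting ones. The latter cut the grid into two sides, each with `2 ^ k` parts, where
`k < K` is a random scale and `4 ^ K` is of order `D`. Choose `2 ^ K` random action coordinates
among the `D` ordinary ones. On each side, the parts are matched at random with the first `2 ^ k`
action coordinates; `node` forgets all action coordinates, and `τ x` is plus or minus the action
coordinate matched with the part of `x`. For a unate function, the sign is the same on both sides;
for a far one, it is reversed on one side. Since the signs are random, `Q` notices only if, for some
action coordinate, it reveals the sign on *both* sides. Let `a i` count the parts in which `Q`
varies along the coordinate `i`, given the other action coordinates; again `∑ i, a i ≤ q`. At
scale `k`, the coordinate `i` is revealed on both sides with probability at most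
`(2 ^ k / D) * (min (a i) (2 ^ k) / 2 ^ k) ^ 2`, up to a constant. Summed over all scales this is
`O(a i / D)` (`sum_scales_le`), since only scales near `log (a i)` matter. Hence a random scale is
bad with probability `O(q / (D * K))` (`card_badLayouts_le`), and `q` has to be of order
`D * K ≈ d log d`.

For `n = 2` and bounded `d` it only has to be seen that at least one query is needed
(`one_le_of_isUnatenessTester`).
-/

namespace UnatenessTesting

open Finset

/-! ### Counting lemmas -/

theorem sum_sum_update {ι κ : Type*} [Fintype ι] [Fintype κ] [DecidableEq ι]
    (F : (ι → κ) → ℕ) (i : ι) :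
    ∑ x : ι → κ, ∑ t : κ, F (Function.update x i t) = Fintype.card κ * ∑ x, F x := by
  have hinv : Function.Involutive
      (fun p : (ι → κ) × κ => (Function.update p.1 i p.2, p.1 i)) := by
    rintro ⟨x, t⟩
    simp
  rw [← Fintype.sum_prod_type (f := fun p : (ι → κ) × κ => F (Function.update p.1 i p.2)),
    Fintype.sum_bijective _ hinv.bijective _ (fun p : (ι → κ) × κ => F p.1) (fun _ => rfl),
    Fintype.sum_prod_type]
  simp [Finset.mul_sum]

/-- A property that ignores the coordinate `i` is independent of the value of that coordinate,
under the uniform distribution. -/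
theorem card_filter_and_apply_mem {ι κ : Type*} [Fintype ι] [Fintype κ] [DecidableEq ι]
    [DecidableEq κ] (A : (ι → κ) → Prop) [DecidablePred A] (i : ι)
    (hA : ∀ x t, A (Function.update x i t) ↔ A x) (T : Finset κ) :
    Fintype.card κ * #{x : ι → κ | A x ∧ x i ∈ T} = #T * #{x : ι → κ | A x} := by
  rw [card_filter, card_filter, ← sum_sum_update _ i, mul_sum]
  refine sum_congr rfl fun x _ => ?_
  by_cases h : A x <;> simp [hA, h]

/-- A matching between `P` and `φ '' P` each of whose pairs is spoiled by `g` bounds the Hamming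
distance from below. -/
theorem card_le_hammingDist {X : Type*} [Fintype X] {f g : X → ℝ} (P : Finset X) (φ : X → X)
    (hφ : Set.InjOn φ P) (hdisj : ∀ x ∈ P, φ x ∉ P)
    (hviol : ∀ x ∈ P, f x = g x → f (φ x) ≠ g (φ x)) : #P ≤ hammingDist f g := by
  classical
  refine card_le_card_of_injOn (fun x => if f x = g x then φ x else x) ?_ ?_
  · intro x hx
    by_cases h : f x = g x
    · simpa [h] using hviol x hx h
    · simp [h]
  · intro x hx y hy hxy
    simp only at hxy
    split_ifs at hxy with h₁ h₂ h₂
    · exact hφ hx hy hxy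
    · exact absurd (hxy ▸ hy) (hdisj x hx)
    · exact absurd (hxy ▸ hx) (hdisj y hy)
    · exact hxy

theorem farFromUnate_of_matching {n d : ℕ} {f : Grid n d → ℝ}
    (h : ∀ g : Grid n d → ℝ, Unate g → ∃ (P : Finset (Grid n d)) (φ : Grid n d → Grid n d),
      Set.InjOn φ P ∧ (∀ x ∈ P, φ x ∉ P) ∧ (∀ x ∈ P, f x = g x → f (φ x) ≠ g (φ x)) ∧
        Fintype.card (Grid n d) ≤ 8 * #P) :
    FarFromUnate (1 / 8) f := by
  intro g hg
  obtain ⟨P, φ, h₁, h₂, h₃, h₄⟩ := h g hg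
  have h₅ := card_le_hammingDist P φ h₁ h₂ h₃
  have h₆ : (Fintype.card (Grid n d) : ℝ) ≤ 8 * (hammingDist f g : ℝ) := by
    exact_mod_cast h₄.trans (Nat.mul_le_mul_left 8 h₅)
  linarith

/-- At least `(n - 2 ^ b) / 2` of the numbers below `n` have their `b`-th binary digit equal
to `1`: those with digit `0` are mapped into them by `t ↦ t + 2 ^ b`, except for the last `2 ^ b`
numbers. -/
theorem le_two_mul_card_bit (n b : ℕ) :
    n ≤ 2 * #{t : Fin n | (t : ℕ) / 2 ^ b % 2 = 1} + 2 ^ b := by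
  have hpos : 0 < 2 ^ b := by positivity
  have h1 : #{t : Fin n | (t : ℕ) / 2 ^ b % 2 = 1} + #{t : Fin n | ¬(t : ℕ) / 2 ^ b % 2 = 1} = n := by
    simpa using card_filter_add_card_filter_not (s := (univ : Finset (Fin n)))
      (fun t : Fin n => (t : ℕ) / 2 ^ b % 2 = 1)
  have h2 : #{t : Fin n | ¬(t : ℕ) / 2 ^ b % 2 = 1} ≤
      #{t : Fin n | (t : ℕ) / 2 ^ b % 2 = 1} + 2 ^ b := by
    have e1 : #{t : Fin n | ¬(t : ℕ) / 2 ^ b % 2 = 1} =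
        #{t : Fin n | ¬(t : ℕ) / 2 ^ b % 2 = 1 ∧ (t : ℕ) + 2 ^ b < n} +
        #{t : Fin n | ¬(t : ℕ) / 2 ^ b % 2 = 1 ∧ ¬ (t : ℕ) + 2 ^ b < n} := by
      rw [← card_filter_add_card_filter_not (fun t : Fin n => (t : ℕ) + 2 ^ b < n),
        filter_filter, filter_filter]
    rw [e1]
    refine Nat.add_le_add ?_ ?_
    · refine card_le_card_of_injOn
        (fun t => if h : (t : ℕ) + 2 ^ b < n then ⟨(t : ℕ) + 2 ^ b, h⟩ else t) ?_ ?_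
      · intro t ht
        simp only [coe_filter, mem_univ, true_and, Set.mem_ofPred_eq] at ht ⊢
        rw [dif_pos ht.2]
        simp only [Nat.add_div_right _ hpos]
        omega
      · intro t ht u hu htu
        simp only [coe_filter, mem_univ, true_and, Set.mem_ofPred_eq] at ht hu
        simp only [dif_pos ht.2, dif_pos hu.2, Fin.mk.injEq] at htu
        ext
        omega
    · refine (card_le_card_of_injOn (fun t : Fin n => n - 1 - (t : ℕ)) (t := range (2 ^ b))
        ?_ ?_).trans (card_range _).le
      · intro t ht
        simp only [coe_filter, mem_univ, true_and, Set.mem_ofPred_eq] at ht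
        simp only [coe_range, Set.mem_Iio]
        omega
      · intro t _ u _ htu
        simp only at htu
        ext
        omega
  omega

/-- If the partition `g` of `A` is coarser than `f`, then `f` has at least one more class than `g`
for every class of `g` on which `f` is not constant. -/
theorem card_branching_add_card_image_le {α β γ : Type*} [DecidableEq β] [DecidableEq γ]
    (A : Finset α) (f : α → β) (g : α → γ) (hfg : ∀ x y, f x = f y → g x = g y)
    (B : Finset γ) (hB : ∀ c ∈ B, ∃ x ∈ A, ∃ y ∈ A, g x = c ∧ g y = c ∧ f x ≠ f y) :
    #B + #(A.image g) ≤ #(A.image f) := by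
  classical
  have hBA : B ⊆ A.image g := fun c hc => by
    obtain ⟨x, hx, -, -, h, -⟩ := hB c hc
    exact mem_image.2 ⟨x, hx, h⟩
  have hfib : (A.image f) = (A.image g).biUnion fun c => (A.filter fun x => g x = c).image f := by
    ext b
    simp only [mem_image, mem_biUnion, mem_filter]
    constructor
    · rintro ⟨x, hx, rfl⟩
      exact ⟨g x, ⟨x, hx, rfl⟩, x, ⟨hx, rfl⟩, rfl⟩
    · rintro ⟨c, -, x, ⟨hx, -⟩, rfl⟩
      exact ⟨x, hx, rfl⟩
  rw [hfib, card_biUnion]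
  · calc #B + #(A.image g) = ∑ c ∈ A.image g, ((if c ∈ B then 1 else 0) + 1) := by
          rw [sum_add_distrib, ← card_filter, filter_mem_eq_inter, inter_eq_right.2 hBA]
          simp
      _ ≤ _ := by
          refine sum_le_sum fun c hc => ?_
          split_ifs with h
          · obtain ⟨x, hx, y, hy, hxc, hyc, hne⟩ := hB c h
            exact one_lt_card.2 ⟨f x, mem_image_of_mem _ (mem_filter.2 ⟨hx, hxc⟩), f y,
              mem_image_of_mem _ (mem_filter.2 ⟨hy, hyc⟩), hne⟩
          · obtain ⟨x, hx, hxc⟩ := mem_image.1 hc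
            exact card_pos.2 ⟨f x, mem_image_of_mem _ (mem_filter.2 ⟨hx, hxc⟩)⟩
  · intro c _ c' _ hcc'
    refine disjoint_left.2 fun b hb hb' => hcc' ?_
    obtain ⟨x, hx, rfl⟩ := mem_image.1 hb
    obtain ⟨y, hy, hxy⟩ := mem_image.1 hb'
    rw [← (mem_filter.1 hx).2, ← (mem_filter.1 hy).2, hfg y x hxy]

/-! ### Yao's principle and hiding by noise -/

theorem FarFromUnate.mono {n d : ℕ} {f : Grid n d → ℝ} {ε ε' : ℝ} (h : FarFromUnate ε' f)
    (hε : ε ≤ ε') : FarFromUnate ε f := fun g hg =>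
  (mul_le_mul_of_nonneg_right hε (Nat.cast_nonneg _)).trans (h g hg)

theorem sum_measureReal_eq_integral_card {Ω Z : Type*} [MeasurableSpace Ω] [Fintype Z]
    (μ : Measure Ω) [IsProbabilityMeasure μ] (S : Z → Ω → Bool)
    (hS : ∀ z, MeasurableSet {ω | S z ω = true}) :
    Integrable (fun ω => (#{z | S z ω = true} : ℝ)) μ ∧
      ∫ ω, (#{z | S z ω = true} : ℝ) ∂μ = ∑ z, μ.real {ω | S z ω = true} := by
  have h : (fun ω => (#{z | S z ω = true} : ℝ)) =
      fun ω => ∑ z, Set.indicator {ω | S z ω = true} (1 : Ω → ℝ) ω := by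
    funext ω
    rw [card_filter]
    push_cast
    refine sum_congr rfl fun z _ => ?_
    simp [Set.indicator_apply]
  have hi : ∀ z, Integrable (Set.indicator {ω | S z ω = true} (1 : Ω → ℝ)) μ := fun z =>
    (integrable_const (1 : ℝ)).indicator (hS z)
  rw [h]
  refine ⟨integrable_finsetSum _ fun z _ => hi z, ?_⟩
  rw [integral_finsetSum _ fun z _ => hi z]
  exact sum_congr rfl fun z _ => integral_indicator_one (hS z)

/-- Yao's principle: a tester fails if for every fixed query set `Q` and every fixed decision rule
the acceptance probabilities on two finite distributions, one on unate functions and one on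
functions far from unate, differ by less than `1 / 3`. -/
theorem not_isUnatenessTester_of_indistinguishable {n d q : ℕ} {ε : ℝ} {Z : Type*} [Fintype Z]
    (yes no : Z → Grid n d → ℝ) (hyes : ∀ z, Unate (yes z)) (hno : ∀ z, FarFromUnate ε (no z))
    (hQ : ∀ Q : Finset (Grid n d), #Q ≤ q → ∀ D : ({x : Grid n d // x ∈ Q} → ℝ) → Bool,
      3 * #{z | D (fun x => yes z x) = true} < 3 * #{z | D (fun x => no z x) = true} +
        Fintype.card Z)
    {Ω : Type*} [MeasurableSpace Ω] (μ : Measure Ω) [IsProbabilityMeasure μ]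
    (T : NonadaptiveAlgorithm (Grid n d) Ω) (hTq : T.MakesAtMost q) :
    ¬ T.IsUnatenessTester μ ε := by
  rintro ⟨hacc, hrej⟩
  obtain ⟨iY, eY⟩ := sum_measureReal_eq_integral_card μ (fun z => T.output (yes z))
    fun z => T.measurableSet_decision (yes z)
  obtain ⟨iN, eN⟩ := sum_measureReal_eq_integral_card μ (fun z => T.output (no z))
    fun z => T.measurableSet_decision (no z)
  have h₁ : (Fintype.card Z : ℝ) * (2 / 3) ≤ ∑ z, μ.real {ω | T.output (yes z) ω = true} := by
    have := card_nsmul_le_sum univ (fun z => μ.real {ω | T.output (yes z) ω = true}) (2 / 3)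
      fun z _ => hacc _ (hyes z)
    simpa using this
  have h₂ : ∑ z, μ.real {ω | T.output (no z) ω = true} ≤ (Fintype.card Z : ℝ) * (1 / 3) := by
    have := sum_le_card_nsmul univ (fun z => μ.real {ω | T.output (no z) ω = true}) (1 / 3)
      fun z _ => ?_
    · simpa using this
    have hc : {ω | T.output (no z) ω = false} = {ω | T.output (no z) ω = true}ᶜ := by
      ext ω
      simp
    have := hrej _ (hno z)
    have hm : MeasurableSet {ω | T.output (no z) ω = true} := T.measurableSet_decision (no z)
    rw [hc, measureReal_compl hm, probReal_univ] at this
    linarith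
  have h₃ : ∫ ω, ((#{z | T.output (yes z) ω = true} : ℝ) - #{z | T.output (no z) ω = true}) ∂μ ≤
      ∫ _ω, ((Fintype.card Z : ℝ) - 1) / 3 ∂μ := by
    refine integral_mono (iY.sub iN) (integrable_const _) fun ω => ?_
    have := hQ (T.queries ω) (hTq ω) (T.decision ω)
    have h' : (3 * #{z | T.output (yes z) ω = true} + 1 : ℝ) ≤
        3 * #{z | T.output (no z) ω = true} + Fintype.card Z := by
      exact_mod_cast this
    simp only
    linarith
  rw [integral_sub iY iN, eY, eN, integral_const] at h₃
  simp only [probReal_univ, smul_eq_mul, one_mul] at h₃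
  linarith

/-- The integer-valued function `W * h + τ`, plus a noise `U` that is constant on every class
`node ⁻¹' {v}`. -/
def noisy {X V : Type*} (W : ℤ) (h : X → ℤ) (node : X → V) (τ : X → ℤ) {K : ℕ} (U : V → Fin K)
    (x : X) : ℝ :=
  ((W * h x + ((U (node x) : ℕ) : ℤ) + τ x : ℤ) : ℝ)

/-- Translating a uniform point of the box `[0, K) ^ V` by a vector with entries of absolute value
at most `C` leaves the box with probability at most `|V| * C / K`. -/
theorem card_box_translate_le {V : Type*} [Fintype V] [DecidableEq V] {K C : ℕ} (s : V → ℤ)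
    (hs : ∀ v, |s v| ≤ C) :
    K * #{U : V → Fin K | ¬ ∀ v, 0 ≤ ((U v : ℕ) : ℤ) + s v ∧ ((U v : ℕ) : ℤ) + s v < K} ≤
      Fintype.card V * C * K ^ Fintype.card V := by
  classical
  let T : V → Finset (Fin K) := fun v =>
    {u : Fin K | ¬ (0 ≤ ((u : ℕ) : ℤ) + s v ∧ ((u : ℕ) : ℤ) + s v < K)}
  have hT : ∀ v, #(T v) ≤ C := by
    intro v
    have hsv := abs_le.1 (hs v)
    refine (card_le_card_of_injOn (t := range C)
      (fun u : Fin K => if 0 ≤ s v then K - 1 - (u : ℕ) else (u : ℕ)) ?_ ?_).trans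
        (card_range _).le
    · intro u hu
      simp only [T, coe_filter, mem_univ, true_and, Set.mem_ofPred_eq] at hu
      simp only [coe_range, Set.mem_Iio]
      split_ifs <;> omega
    · intro u _ u' _ huu'
      simp only at huu'
      ext
      split_ifs at huu' <;> omega
  calc K * #{U : V → Fin K | ¬ ∀ v, 0 ≤ ((U v : ℕ) : ℤ) + s v ∧ ((U v : ℕ) : ℤ) + s v < K}
      ≤ K * ∑ v, #{U : V → Fin K | True ∧ U v ∈ T v} := by
        refine Nat.mul_le_mul_left _ (le_trans (card_le_card fun U hU => ?_) card_biUnion_le)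
        simp only [mem_filter, mem_univ, true_and, not_forall] at hU
        obtain ⟨v, hv⟩ := hU
        simp only [mem_biUnion, mem_filter, mem_univ, true_and, T]
        exact ⟨v, hv⟩
    _ = ∑ v, #(T v) * K ^ Fintype.card V := by
        rw [mul_sum]
        refine sum_congr rfl fun v _ => ?_
        have := card_filter_and_apply_mem (κ := Fin K) (fun _ : V → Fin K => True) v
          (fun _ _ => Iff.rfl) (T v)
        simpa using this
    _ ≤ ∑ v : V, C * K ^ Fintype.card V :=
        sum_le_sum fun v _ => Nat.mul_le_mul_right _ (hT v)
    _ = _ := by simp [mul_assoc]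

/-- If on `Q` the terms `τ₁` and `τ₂` differ by a function of the node, this difference is
absorbed by the noise, up to boundary effects. -/
theorem card_noisy_le {X V : Type*} [Fintype V] [DecidableEq V] {K C : ℕ}
    (W : ℤ) (h : X → ℤ) (node : X → V) (τ₁ τ₂ : X → ℤ) (Q : Finset X)
    (hC : ∀ x, |τ₁ x - τ₂ x| ≤ C)
    (hτ : ∀ x ∈ Q, ∀ y ∈ Q, node x = node y → τ₁ x - τ₂ x = τ₁ y - τ₂ y)
    (D : ({x : X // x ∈ Q} → ℝ) → Bool) :
    K * #{U : V → Fin K | D (fun x => noisy W h node τ₁ U x) = true} ≤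
      K * #{U : V → Fin K | D (fun x => noisy W h node τ₂ U x) = true} +
        Fintype.card V * C * K ^ Fintype.card V := by
  classical
  obtain ⟨s, hs, hsQ⟩ : ∃ s : V → ℤ, (∀ v, |s v| ≤ C) ∧
      ∀ x ∈ Q, τ₁ x = τ₂ x + s (node x) := by
    refine ⟨fun v => if hv : ∃ x ∈ Q, node x = v then τ₁ hv.choose - τ₂ hv.choose else 0,
      fun v => ?_, fun x hx => ?_⟩
    · by_cases hv : ∃ x ∈ Q, node x = v
      · simpa only [dif_pos hv] using hC _
      · simp [dif_neg hv]
    · have hv : ∃ y ∈ Q, node y = node x := ⟨x, hx, rfl⟩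
      have := hτ _ hv.choose_spec.1 x hx hv.choose_spec.2
      simp only [dif_pos hv]
      omega
  refine le_trans ?_ (Nat.add_le_add_left (card_box_translate_le s hs) _)
  rw [← Nat.mul_add]
  refine Nat.mul_le_mul_left _ ?_
  rw [← card_filter_add_card_filter_not
    (fun U : V → Fin K => ∀ v, 0 ≤ ((U v : ℕ) : ℤ) + s v ∧ ((U v : ℕ) : ℤ) + s v < K),
    filter_filter, filter_filter]
  refine Nat.add_le_add ?_ (card_le_card fun U hU => ?_)
  · refine card_le_card_of_injOn (fun U => if hU : ∀ v, 0 ≤ ((U v : ℕ) : ℤ) + s v ∧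
      ((U v : ℕ) : ℤ) + s v < K then
        fun v => ⟨(((U v : ℕ) : ℤ) + s v).toNat, by have := hU v; omega⟩ else U) ?_ ?_
    · intro U hU
      simp only [coe_filter, mem_univ, true_and, Set.mem_ofPred_eq] at hU ⊢
      rw [dif_pos hU.2]
      refine (congrArg D (funext fun x => ?_)).trans hU.1
      have h₁ := hsQ x x.2
      have h₂ := (hU.2 (node x)).1
      unfold noisy
      rw [h₁]
      simp only [Int.toNat_of_nonneg h₂]
      congr 1
      ring
    · intro U hU U' hU' hUU'
      simp only [coe_filter, mem_univ, true_and, Set.mem_ofPred_eq] at hU hU'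
      simp only [dif_pos hU.2, dif_pos hU'.2] at hUU'
      funext v
      have h₁ := congrArg Fin.val (congrFun hUU' v)
      have h₂ := (hU.2 v).1
      have h₃ := (hU'.2 v).1
      simp only at h₁
      ext
      omega
  · simp only [mem_filter, mem_univ, true_and] at hU ⊢
    exact hU.2

/-- The form of Yao's principle used for both hard distributions. An instance `j` yields the unate
functions `W * h j + U + τY j` and the far functions `W * h j + U + τN j`. For every query set `Q`,
all but a quarter of the yes-instances `j` must have a counterpart `e j` among the no-instances that
is the same on `Q` up to the noise. -/
theorem not_isUnatenessTester_of_hidden {n d q C : ℕ} {J V : Type*} [Fintype J] [Nonempty J]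
    [Fintype V] (h : J → Grid n d → ℤ) (node : J → Grid n d → V) (τY τN : J → Grid n d → ℤ)
    (hyes : ∀ (K : ℕ) (W : ℤ), K + C ≤ W → ∀ (j : J) (U : V → Fin K),
      Unate (noisy W (h j) (node j) (τY j) U))
    (hno : ∀ (K : ℕ) (W : ℤ), K + C ≤ W → ∀ (j : J) (U : V → Fin K),
      FarFromUnate (1 / 8) (noisy W (h j) (node j) (τN j) U))
    (hC : ∀ j j' x, |τY j x - τN j' x| ≤ C)
    (hid : ∀ Q : Finset (Grid n d), #Q ≤ q → ∃ (e : Equiv.Perm J) (bad : Finset J),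
      4 * #bad ≤ Fintype.card J ∧ ∀ j ∉ bad, h (e j) = h j ∧ node (e j) = node j ∧
        ∀ x ∈ Q, ∀ y ∈ Q, node j x = node j y →
          τY j x - τN (e j) x = τY j y - τN (e j) y)
    {ε : ℝ} (hε : ε ≤ 1 / 8) {Ω : Type*} [MeasurableSpace Ω] (μ : Measure Ω)
    [IsProbabilityMeasure μ] (T : NonadaptiveAlgorithm (Grid n d) Ω) (hTq : T.MakesAtMost q) :
    ¬ T.IsUnatenessTester μ ε := by
  classical
  -- The noise range `K` makes the boundary effect `|V| * C / K` smaller than `1 / 12`.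
  set K : ℕ := 12 * (Fintype.card V * C) + 1 with hK
  set W : ℤ := K + C with hW
  refine not_isUnatenessTester_of_indistinguishable (Z := J × (V → Fin K))
    (fun z => noisy W (h z.1) (node z.1) (τY z.1) z.2)
    (fun z => noisy W (h z.1) (node z.1) (τN z.1) z.2)
    (fun z => hyes K W hW.ge z.1 z.2) (fun z => (hno K W hW.ge z.1 z.2).mono hε) ?_ μ T hTq
  intro Q hQ D
  obtain ⟨e, bad, hbad, he⟩ := hid Q hQ
  set y : J → ℕ := fun j =>
    #{U : V → Fin K | D (fun x => noisy W (h j) (node j) (τY j) U x) = true} with hy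
  set z : J → ℕ := fun j =>
    #{U : V → Fin K | D (fun x => noisy W (h j) (node j) (τN j) U x) = true} with hz
  set B : ℕ := K ^ Fintype.card V with hB
  have hBpos : 0 < B := by positivity
  have hsumY : #{p : J × (V → Fin K) |
      D (fun x => noisy W (h p.1) (node p.1) (τY p.1) p.2 x) = true} = ∑ j, y j := by
    simp only [hy, card_filter]
    exact Fintype.sum_prod_type _
  have hsumN : #{p : J × (V → Fin K) |
      D (fun x => noisy W (h p.1) (node p.1) (τN p.1) p.2 x) = true} = ∑ j, z j := by
    simp only [hz, card_filter]
    exact Fintype.sum_prod_type _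
  have hcard : Fintype.card (J × (V → Fin K)) = Fintype.card J * B := by
    simp [hB]
  rw [hsumY, hsumN, hcard]
  have hgood : ∀ j, K * y j ≤ K * z (e j) + Fintype.card V * C * B + if j ∈ bad then K * B else 0 := by
    intro j
    split_ifs with hj
    · have : y j ≤ B := (card_le_univ _).trans (by simp [hB])
      have := Nat.mul_le_mul_left K this
      omega
    · obtain ⟨h₁, h₂, h₃⟩ := he j hj
      have := card_noisy_le (K := K) W (h j) (node j) (τY j) (τN (e j)) Q (hC j (e j)) h₃ D
      simp only [hy, hz, h₁, h₂]
      simpa using this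
  have hsum : K * ∑ j, y j ≤ K * ∑ j, z j + Fintype.card J * (Fintype.card V * C * B) +
      #bad * (K * B) := by
    calc K * ∑ j, y j ≤ ∑ j, (K * z (e j) + Fintype.card V * C * B +
            if j ∈ bad then K * B else 0) := by
          rw [mul_sum]
          exact sum_le_sum fun j _ => hgood j
      _ = _ := by
          rw [sum_add_distrib, sum_add_distrib, ← mul_sum, Equiv.sum_comp e z]
          simp
  have hJ : 0 < Fintype.card J := Fintype.card_pos
  have hKpos : 0 < K := by omega
  have h12 : 12 * (Fintype.card J * (Fintype.card V * C * B)) < Fintype.card J * (K * B) := by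
    have : 12 * (Fintype.card V * C) < K := by omega
    have := Nat.mul_lt_mul_of_pos_left
      (Nat.mul_lt_mul_of_pos_right this hBpos) hJ
    calc _ = Fintype.card J * (12 * (Fintype.card V * C) * B) := by ring
      _ < _ := this
  have hb := Nat.mul_le_mul_right (K * B) hbad
  refine lt_of_mul_lt_mul_left (a := K) ?_ hKpos.le
  have e₁ : K * (3 * ∑ j, y j) = 3 * (K * ∑ j, y j) := by ring
  have e₂ : K * (3 * ∑ j, z j + Fintype.card J * B) =
    3 * (K * ∑ j, z j) + Fintype.card J * (K * B) := by ring
  have e₃ : 4 * #bad * (K * B) = 4 * (#bad * (K * B)) := by ring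
  rw [e₁, e₂]
  rw [e₃] at hb
  omega

/-! ### The lower bound in the side length -/

theorem sum_range_add_le {u a : ℕ → ℕ} {m : ℕ} (h : ∀ i < m, u i + a (i + 1) ≤ a i) :
    ∑ i ∈ range m, u i + a m ≤ a 0 := by
  induction m with
  | zero => simp
  | succ m ih =>
    have h₁ := ih fun i hi => h i (by omega)
    have h₂ := h m (by omega)
    rw [sum_range_succ]
    omega

section noisy

variable {X V : Type*} {W : ℤ} {h : X → ℤ} {node : X → V} {τ : X → ℤ} {K C : ℕ} {U : V → Fin K}
  {x y : X}

theorem noisy_lt_of_lt (hW : K + C ≤ W) (hC : τ x - τ y ≤ C) (hxy : h x < h y) :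
    noisy W h node τ U x < noisy W h node τ U y := by
  unfold noisy
  have h₁ := (U (node x)).2
  have h₂ : W ≤ W * (h y - h x) := le_mul_of_one_le_right (by omega) (by omega)
  rw [mul_sub] at h₂
  exact_mod_cast (by omega : W * h x + ((U (node x) : ℕ) : ℤ) + τ x <
    W * h y + ((U (node y) : ℕ) : ℤ) + τ y)

theorem noisy_le_noisy_iff (hn : node x = node y) (hxy : h x = h y) :
    noisy W h node τ U x ≤ noisy W h node τ U y ↔ τ x ≤ τ y := by
  unfold noisy
  rw [hn, hxy, Int.cast_le]
  omega

end noisy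

theorem sum_val_update_lt {n d : ℕ} (x : Grid n d) (i : Fin d) {a b : Fin n} (hab : a < b) :
    ∑ c, ((Function.update x i a c : ℕ) : ℤ) < ∑ c, ((Function.update x i b c : ℕ) : ℤ) := by
  refine sum_lt_sum (fun c _ => ?_) ⟨i, mem_univ i, by simpa using hab⟩
  by_cases hc : c = i
  · subst hc
    simpa using hab.le
  · simp [hc]

/-- Subtract `2 ^ b` from the `i`-th coordinate (truncated at `0`). -/
def bitDown {n d : ℕ} (i : Fin d) (b : ℕ) (x : Grid n d) : Grid n d :=
  Function.update x i ⟨x i - 2 ^ b, (Nat.sub_le _ _).trans_lt (x i).2⟩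

theorem two_pow_le_of_bit {t b : ℕ} (h : t / 2 ^ b % 2 = 1) : 2 ^ b ≤ t := by
  by_contra hlt
  rw [Nat.div_eq_of_lt (not_le.1 hlt)] at h
  omega

theorem bit_sub_two_pow {t b : ℕ} (h : t / 2 ^ b % 2 = 1) : (t - 2 ^ b) / 2 ^ b % 2 = 0 := by
  have h₁ := Nat.sub_mul_div t (2 ^ b) 1
  rw [mul_one] at h₁
  omega

section bitDown

variable {n d : ℕ} {i : Fin d} {b : ℕ} {x y : Grid n d}

@[simp]
theorem bitDown_apply_self : ((bitDown i b x i : Fin n) : ℕ) = x i - 2 ^ b := by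
  simp [bitDown]

theorem bitDown_apply_of_ne {c : Fin d} (h : c ≠ i) : bitDown i b x c = x c := by
  simp [bitDown, h]

theorem eq_of_bitDown_eq (hx : (x i : ℕ) / 2 ^ b % 2 = 1) (hy : (y i : ℕ) / 2 ^ b % 2 = 1)
    (h : bitDown i b x = bitDown i b y) : x = y := by
  funext c
  by_cases hc : c = i
  · subst hc
    have h₁ : ((bitDown c b x c : Fin n) : ℕ) = bitDown c b y c := by rw [h]
    rw [bitDown_apply_self, bitDown_apply_self] at h₁
    have := two_pow_le_of_bit hx
    have := two_pow_le_of_bit hy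
    ext
    omega
  · rw [← bitDown_apply_of_ne (b := b) (x := x) hc, h, bitDown_apply_of_ne hc]

theorem le_of_monotone_bitDown {g : Grid n d → ℝ}
    (hg : ∀ x : Grid n d, Monotone fun a : Fin n => g (Function.update x i a)) (b : ℕ)
    (x : Grid n d) : g (bitDown i b x) ≤ g x := by
  have := hg x (a := ⟨x i - 2 ^ b, (Nat.sub_le _ _).trans_lt (x i).2⟩) (b := x i)
    (Fin.mk_le_of_le_val (Nat.sub_le _ _))
  simpa [bitDown] using this

theorem le_of_antitone_bitDown {g : Grid n d → ℝ}
    (hg : ∀ x : Grid n d, Antitone fun a : Fin n => g (Function.update x i a)) (b : ℕ)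
    (x : Grid n d) : g x ≤ g (bitDown i b x) := by
  have := hg x (a := ⟨x i - 2 ^ b, (Nat.sub_le _ _).trans_lt (x i).2⟩) (b := x i)
    (Fin.mk_le_of_le_val (Nat.sub_le _ _))
  simpa [bitDown] using this

end bitDown

theorem card_grid_le_bit {n d : ℕ} (i : Fin d) {b : ℕ} (hb : 4 * 2 ^ b ≤ 3 * n) :
    Fintype.card (Grid n d) ≤ 8 * #{x : Grid n d | (x i : ℕ) / 2 ^ b % 2 = 1} := by
  have h₁ := card_filter_and_apply_mem (κ := Fin n) (fun _ : Fin d → Fin n => True) i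
    (fun _ _ => Iff.rfl) {t : Fin n | (t : ℕ) / 2 ^ b % 2 = 1}
  have h₂ := le_two_mul_card_bit n b
  have hpos : 0 < 2 ^ b := by positivity
  simp only [mem_filter, mem_univ, true_and, Fintype.card_fin, filter_true, card_univ] at h₁
  refine le_of_mul_le_mul_left (a := n) ?_ (by omega)
  rw [mul_left_comm, h₁, ← mul_assoc]
  exact Nat.mul_le_mul_right _ (by omega)

/-- Erase the `b` lowest binary digits of the `i`-th coordinate. -/
def coarsen {n d : ℕ} (i : Fin d) (b : ℕ) (x : Grid n d) : Grid n d :=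
  Function.update x i ⟨x i / 2 ^ b, (Nat.div_le_self _ _).trans_lt (x i).2⟩

theorem coarsen_update_self {n d : ℕ} (i : Fin d) (b : ℕ) (x : Grid n d) (a : Fin n) :
    coarsen i b (Function.update x i a) =
      Function.update x i ⟨a / 2 ^ b, (Nat.div_le_self _ _).trans_lt a.2⟩ := by
  simp [coarsen]

theorem coarsen_update_of_ne {n d : ℕ} {i c : Fin d} (h : c ≠ i) (b : ℕ) (x : Grid n d)
    (a : Fin n) :
    coarsen i b (Function.update x c a) = Function.update (coarsen i b x) c a := by
  simp only [coarsen, Function.update_of_ne h.symm, Function.update_comm h.symm]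

/-- The binary digit number `j` of the `i`-th coordinate. -/
def coordBit {n d : ℕ} (i : Fin d) (j : ℕ) (x : Grid n d) : ℤ := ((x i / 2 ^ j % 2 : ℕ) : ℤ)

theorem coordBit_nonneg {n d : ℕ} (i : Fin d) (j : ℕ) (x : Grid n d) : 0 ≤ coordBit i j x :=
  Int.natCast_nonneg _

theorem coordBit_le_one {n d : ℕ} (i : Fin d) (j : ℕ) (x : Grid n d) : coordBit i j x ≤ 1 := by
  unfold coordBit
  omega

/-- Among points with the same higher digits of the coordinate `i`, the values follow the `j`-th
digit; otherwise `W` makes the higher digits, or another coordinate, decide. -/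
theorem unate_noisy_coordBit {n d : ℕ} (i : Fin d) (j : ℕ) {K : ℕ} {W : ℤ}
    (hW : K + (2 : ℕ) ≤ W) (U : Grid n d → Fin K) :
    Unate (noisy W (fun x => ∑ c, ((coarsen i (j + 1) x c : ℕ) : ℤ)) (coarsen i (j + 1))
      (coordBit i j) U) := by
  intro c
  refine Or.inl fun x a b hab => ?_
  rcases hab.eq_or_lt with rfl | hlt
  · exact le_rfl
  have hbound : ∀ x y : Grid n d, coordBit i j x - coordBit i j y ≤ (2 : ℕ) := fun x y => by
    have := coordBit_nonneg i j y
    have := coordBit_le_one i j x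
    push_cast
    omega
  by_cases hc : c = i
  · subst hc
    rcases (Nat.div_le_div_right (c := 2 ^ (j + 1)) (Fin.le_def.1 hab)).eq_or_lt with heq | hlt'
    · have hnode : coarsen c (j + 1) (Function.update x c a) =
          coarsen c (j + 1) (Function.update x c b) := by
        simp only [coarsen_update_self, heq]
      refine (noisy_le_noisy_iff hnode (by rw [hnode])).2 ?_
      have h₁ := Nat.div_le_div_right (c := 2 ^ j) (Fin.le_def.1 hab)
      rw [pow_succ, ← Nat.div_div_eq_div_mul, ← Nat.div_div_eq_div_mul] at heq
      simp only [coordBit, Function.update_self]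
      omega
    · refine (noisy_lt_of_lt hW (hbound _ _) ?_).le
      simp only [coarsen_update_self]
      exact sum_val_update_lt x c hlt'
  · refine (noisy_lt_of_lt hW (hbound _ _) ?_).le
    simp only [coarsen_update_of_ne hc]
    exact sum_val_update_lt _ c hlt

/-- Along the coordinate `i`, the values increase with the digits above the `j`-th one and
decrease with the `j`-th digit, so that neither direction is close to being respected. -/
theorem farFromUnate_noisy_neg_coordBit {n d : ℕ} (i : Fin d) {j : ℕ} (hj : 2 ^ (j + 3) ≤ 3 * n)
    {K : ℕ} {W : ℤ} (hW : K + (2 : ℕ) ≤ W) (U : Grid n d → Fin K) :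
    FarFromUnate (1 / 8) (noisy W (fun x => ∑ c, ((coarsen i (j + 1) x c : ℕ) : ℤ))
      (coarsen i (j + 1)) (fun x => -coordBit i j x) U) := by
  have hdisj : ∀ b, ∀ x ∈ ({x | (x i : ℕ) / 2 ^ b % 2 = 1} : Finset (Grid n d)),
      bitDown i b x ∉ ({x | (x i : ℕ) / 2 ^ b % 2 = 1} : Finset (Grid n d)) := by
    intro b x hx
    simp only [mem_filter, mem_univ, true_and] at hx
    simp [bit_sub_two_pow hx]
  have hinj : ∀ b, Set.InjOn (bitDown i b)
      (({x | (x i : ℕ) / 2 ^ b % 2 = 1} : Finset (Grid n d)) : Set (Grid n d)) := by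
    intro b x hx y hy hxy
    exact eq_of_bitDown_eq (by simpa using hx) (by simpa using hy) hxy
  refine farFromUnate_of_matching fun g hg => ?_
  rcases hg i with hmono | hanti
  · refine ⟨({x | (x i : ℕ) / 2 ^ j % 2 = 1} : Finset (Grid n d)), bitDown i j, hinj j, hdisj j,
      fun x hx h₁ h₂ => ?_, card_grid_le_bit i ?_⟩
    · simp only [mem_filter, mem_univ, true_and] at hx
      have hle := le_of_monotone_bitDown hmono j x
      have hsub := two_pow_le_of_bit hx
      have hbit := bit_sub_two_pow hx
      have hdiv := Nat.sub_mul_div (x i : ℕ) (2 ^ j) 1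
      rw [mul_one] at hdiv
      have hnode : coarsen i (j + 1) (bitDown i j x) = coarsen i (j + 1) x := by
        have : ((x i : ℕ) - 2 ^ j) / 2 ^ (j + 1) = (x i : ℕ) / 2 ^ (j + 1) := by
          rw [pow_succ, ← Nat.div_div_eq_div_mul, ← Nat.div_div_eq_div_mul, hdiv]
          generalize (x i : ℕ) / 2 ^ j = a at hx
          omega
        rw [bitDown, coarsen_update_self]
        simp only [this, coarsen]
      rw [← h₁, ← h₂, noisy_le_noisy_iff hnode (by rw [hnode])] at hle
      simp only [coordBit, bitDown_apply_self, hx, hbit] at hle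
      omega
    · rw [pow_add] at hj
      have : 0 < 2 ^ j := by positivity
      omega
  · refine ⟨({x | (x i : ℕ) / 2 ^ (j + 1) % 2 = 1} : Finset (Grid n d)), bitDown i (j + 1),
      hinj (j + 1), hdisj (j + 1), fun x hx h₁ h₂ => ?_, card_grid_le_bit i ?_⟩
    · simp only [mem_filter, mem_univ, true_and] at hx
      have hle := le_of_antitone_bitDown hanti (j + 1) x
      refine absurd hle (not_le.2 ?_)
      rw [← h₁, ← h₂]
      refine noisy_lt_of_lt hW ?_ ?_
      · have := coordBit_nonneg i j (bitDown i (j + 1) x)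
        have := coordBit_le_one i j x
        push_cast
        omega
      · have hdiv := Nat.sub_mul_div (x i : ℕ) (2 ^ (j + 1)) 1
        rw [mul_one] at hdiv
        unfold bitDown
        simp only [coarsen_update_self]
        refine sum_val_update_lt x i (Fin.lt_def.2 ?_)
        simp only [hdiv]
        generalize (x i : ℕ) / 2 ^ (j + 1) = a at hx
        omega
    · rw [pow_succ 2 (j + 2), pow_succ 2 (j + 1)] at hj
      omega

/-- A set of `q` points contains pairs that differ in the `j`-th digit of the coordinate `i`, but
neither in a higher digit of it nor in another coordinate, for at most `q` pairs `(i, j)`. -/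
theorem card_separated_bits_le {n d : ℕ} (L : ℕ) (Q : Finset (Grid n d)) :
    #{p : Fin d × Fin L | ∃ x ∈ Q, ∃ y ∈ Q, coarsen p.1 (p.2 + 1) x = coarsen p.1 (p.2 + 1) y ∧
      coordBit p.1 p.2 x ≠ coordBit p.1 p.2 y} ≤ #Q := by
  classical
  -- `π i j x` forgets all coordinates before `i` and the `j` lowest digits of the coordinate `i`.
  let π : ℕ → ℕ → Grid n d → Fin d → ℕ := fun i j x c =>
    if (c : ℕ) < i then 0 else if (c : ℕ) = i then x c / 2 ^ j else x c
  let sep : ℕ → ℕ → ℕ := fun i j => if ∃ x ∈ Q, ∃ y ∈ Q,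
    π i (j + 1) x = π i (j + 1) y ∧ π i j x ≠ π i j y then 1 else 0
  have hstep : ∀ i j, sep i j + #(Q.image (π i (j + 1))) ≤ #(Q.image (π i j)) := by
    intro i j
    have hcoarse : ∀ x y, π i j x = π i j y → π i (j + 1) x = π i (j + 1) y := by
      intro x y hxy
      funext c
      have hc := congrFun hxy c
      simp only [π] at hc ⊢
      split_ifs at hc ⊢
      · rfl
      · rw [pow_succ, ← Nat.div_div_eq_div_mul, ← Nat.div_div_eq_div_mul, hc]
      · exact hc
    simp only [sep]
    split_ifs with h
    · obtain ⟨x, hx, y, hy, h₁, h₂⟩ := h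
      refine card_branching_add_card_image_le Q _ _ hcoarse {π i (j + 1) x} ?_
      intro c hc
      rw [mem_singleton] at hc
      subst hc
      exact ⟨x, hx, y, hy, rfl, h₁.symm, h₂⟩
    · exact card_branching_add_card_image_le Q _ _ hcoarse ∅ (by simp)
  have hcoord : ∀ i, ∑ j ∈ range L, sep i j + #(Q.image (π (i + 1) 0)) ≤ #(Q.image (π i 0)) := by
    intro i
    have h₁ := sum_range_add_le (a := fun j => #(Q.image (π i j))) (m := L)
      fun j _ => hstep i j
    have h₂ : #(Q.image (π (i + 1) 0)) ≤ #(Q.image (π i L)) := by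
      have := card_branching_add_card_image_le Q (π i L) (π (i + 1) 0) ?_ ∅ (by simp)
      · simpa using this
      intro x y hxy
      funext c
      have hc := congrFun hxy c
      simp only [π] at hc ⊢
      split_ifs at hc ⊢ <;> first | rfl | omega
    omega
  have hall := sum_range_add_le (a := fun i => #(Q.image (π i 0))) (m := d)
    fun i _ => hcoord i
  calc _ = ∑ p : Fin d × Fin L, if ∃ x ∈ Q, ∃ y ∈ Q,
          coarsen p.1 (p.2 + 1) x = coarsen p.1 (p.2 + 1) y ∧
            coordBit p.1 p.2 x ≠ coordBit p.1 p.2 y then 1 else 0 := card_filter _ _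
    _ ≤ ∑ p : Fin d × Fin L, sep p.1 p.2 := by
        refine sum_le_sum fun p _ => ?_
        simp only [sep]
        split_ifs with h h' <;> first | exact le_rfl | exact Nat.zero_le _ | skip
        refine absurd ?_ h'
        obtain ⟨x, hx, y, hy, h₁, h₂⟩ := h
        refine ⟨x, hx, y, hy, ?_, fun h₃ => h₂ ?_⟩
        · funext c
          have hc := congrArg Fin.val (congrFun h₁ c)
          simp only [π]
          split_ifs with h₄ h₅
          · rfl
          · have : c = p.1 := Fin.ext h₅
            subst this
            simpa [coarsen] using hc
          · have : c ≠ p.1 := fun h => h₅ (by rw [h])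
            simpa [coarsen, this] using hc
        · have hc := congrFun h₃ p.1
          simp only [π, lt_irrefl, if_false, if_true] at hc
          simp only [coordBit, hc]
    _ = ∑ i ∈ range d, ∑ j ∈ range L, sep i j := by
        rw [Fintype.sum_prod_type, Finset.sum_range]
        exact sum_congr rfl fun i _ => (Finset.sum_range (sep i)).symm
    _ ≤ #(Q.image (π 0 0)) := by
        omega
    _ ≤ #Q := card_image_le

/-- The part of the lower bound that comes from the length of the coordinates. -/
theorem lt_four_mul_of_isUnatenessTester {n d q L : ℕ} (hd : 1 ≤ d) (hL : 1 ≤ L)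
    (hLn : 2 ^ (L + 2) ≤ 3 * n) {ε : ℝ} (hε : ε ≤ 1 / 8) {Ω : Type*} [MeasurableSpace Ω]
    (μ : Measure Ω) [IsProbabilityMeasure μ] (T : NonadaptiveAlgorithm (Grid n d) Ω)
    (hT : T.IsUnatenessTester μ ε) (hTq : T.MakesAtMost q) : d * L < 4 * q := by
  classical
  by_contra! hq
  have : Nonempty (Fin d × Fin L) := ⟨⟨⟨0, hd⟩, ⟨0, hL⟩⟩⟩
  refine not_isUnatenessTester_of_hidden (J := Fin d × Fin L) (C := 2) (q := q)
    (fun p x => ∑ c, ((coarsen p.1 (p.2 + 1) x c : ℕ) : ℤ)) (fun p => coarsen p.1 (p.2 + 1))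
    (fun p => coordBit p.1 p.2) (fun p x => -coordBit p.1 p.2 x)
    (fun K W hW p U => unate_noisy_coordBit p.1 p.2 hW U)
    (fun K W hW p U => farFromUnate_noisy_neg_coordBit p.1
      ((Nat.pow_le_pow_right two_pos (by omega)).trans hLn) hW U)
    (fun p p' x => ?_) (fun Q hQ => ?_) hε μ T hTq hT
  · have := coordBit_nonneg p.1 p.2 x
    have := coordBit_le_one p.1 p.2 x
    have := coordBit_nonneg p'.1 p'.2 x
    have := coordBit_le_one p'.1 p'.2 x
    rw [abs_le]
    push_cast
    omega
  · refine ⟨Equiv.refl _, univ.filter fun p : Fin d × Fin L => ∃ x ∈ Q, ∃ y ∈ Q,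
      coarsen p.1 (p.2 + 1) x = coarsen p.1 (p.2 + 1) y ∧
        coordBit p.1 p.2 x ≠ coordBit p.1 p.2 y, ?_, fun p hp => ⟨rfl, rfl, ?_⟩⟩
    · have := card_separated_bits_le L Q
      simp only [Fintype.card_prod, Fintype.card_fin]
      omega
    · intro x hx y hy hxy
      simp only [mem_filter, mem_univ, true_and, not_exists, not_and, not_not] at hp
      simp only [Equiv.refl_apply]
      rw [hp x hx y hy hxy]

/-! ### The second hard distribution -/

/-- Replace by `0` all coordinates in `S`. -/
def forget {n m : ℕ} (S : Finset (Fin m)) (x : Grid n m) : Grid n m :=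
  fun c => if c ∈ S then ⟨0, (x c).pos⟩ else x c

section forget

variable {n m : ℕ} {S : Finset (Fin m)} {x y : Grid n m} {c : Fin m}

theorem forget_apply_of_notMem (h : c ∉ S) : forget S x c = x c := by simp [forget, h]

theorem forget_eq_forget_iff : forget S x = forget S y ↔ ∀ c ∉ S, x c = y c := by
  constructor
  · intro h c hc
    rw [← forget_apply_of_notMem (x := x) hc, h, forget_apply_of_notMem hc]
  · intro h
    funext c
    by_cases hc : c ∈ S
    · simp [forget, hc]
    · simp [forget, hc, h c hc]

theorem forget_update_of_mem (h : c ∈ S) (a : Fin n) :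
    forget S (Function.update x c a) = forget S x := by
  refine forget_eq_forget_iff.2 fun c' hc' => ?_
  rw [Function.update_of_ne]
  rintro rfl
  exact hc' h

theorem forget_update_of_notMem (h : c ∉ S) (a : Fin n) :
    forget S (Function.update x c a) = Function.update (forget S x) c a := by
  funext c'
  by_cases hc : c' = c
  · subst hc
    simp [forget, h]
  · simp [forget, hc]

end forget

/-- The last `t` coordinates, read as the base-`n` digits of a number below `n ^ t`. -/
def selector {n D t : ℕ} (x : Grid n (D + t)) : ℕ :=
  (finFunctionFinEquiv fun c : Fin t => x (Fin.natAdd D c) : Fin (n ^ t))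

theorem selector_congr {n D t : ℕ} {x y : Grid n (D + t)}
    (h : ∀ c : Fin t, x (Fin.natAdd D c) = y (Fin.natAdd D c)) : selector x = selector y := by
  unfold selector
  rw [funext h]

theorem selector_update_castAdd {n D t : ℕ} (x : Grid n (D + t)) (i : Fin D) (a : Fin n) :
    selector (Function.update x (Fin.castAdd t i) a) = selector x :=
  selector_congr fun c => Function.update_of_ne
    (fun h => by
      have := congrArg Fin.val h
      simp only [Fin.val_natAdd, Fin.val_castAdd] at this
      omega) _ _

theorem card_selector {n D t : ℕ} (p : ℕ → Prop) [DecidablePred p] :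
    #{x : Grid n (D + t) | p (selector x)} = n ^ D * #{v : Fin (n ^ t) | p v} := by
  let e : (Fin D → Fin n) × Fin (n ^ t) ≃ Grid n (D + t) :=
    ((Equiv.refl _).prodCongr finFunctionFinEquiv.symm).trans (Fin.appendEquiv D t)
  have he : ∀ z, selector (e z) = z.2 := by
    intro z
    simp only [selector, e, Fin.appendEquiv]
    simp
  have h : #{x : Grid n (D + t) | p (selector x)} =
      #((univ : Finset (Fin D → Fin n)) ×ˢ ({v : Fin (n ^ t) | p v} : Finset _)) := by
    refine (card_equiv e fun z => ?_).symm
    simp [he]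
  rw [h, card_product]
  simp

/-- The shift that applies on side `b` of the grid. -/
def sideShift {M : ℕ} (w : Fin M × Fin M) (b : ℕ) : ℕ := if b = 0 then w.1 else w.2

/-- The number of the coordinate that is active at `x`, at scale `k`. The grid has two sides,
given by the parity of the selector; each side is cut into `2 ^ k` parts by the next `k` binary
digits of the selector, and these parts are assigned to the numbers below `2 ^ k` by a cyclic shift
depending on the side. -/
def slot {n D t K : ℕ} (k : Fin K) (w : Fin (2 ^ K) × Fin (2 ^ K)) (x : Grid n (D + t)) :
    Fin (2 ^ K) :=
  ⟨(selector x / 2 + sideShift w (selector x % 2)) % 2 ^ (k : ℕ),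
    (Nat.mod_lt _ (by positivity)).trans_le (Nat.pow_le_pow_right two_pos k.2.le)⟩

theorem slot_congr {n D t K : ℕ} {k : Fin K} {w : Fin (2 ^ K) × Fin (2 ^ K)}
    {x y : Grid n (D + t)} (h : selector x = selector y) : slot k w x = slot k w y := by
  simp only [slot, h]

/-- The set of all action coordinates, which are named by `r`. -/
def actionSet {D M : ℕ} (t : ℕ) (r : Fin M → Fin D) : Finset (Fin (D + t)) :=
  univ.image fun j => Fin.castAdd t (r j)

theorem castAdd_mem_actionSet {D t M : ℕ} (r : Fin M → Fin D) (j : Fin M) :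
    Fin.castAdd t (r j) ∈ actionSet t r := mem_image_of_mem _ (mem_univ j)

theorem natAdd_notMem_actionSet {D t M : ℕ} (r : Fin M → Fin D) (c : Fin t) :
    Fin.natAdd D c ∉ actionSet t r := by
  intro h
  obtain ⟨j, -, hj⟩ := mem_image.1 h
  have := congrArg Fin.val hj
  simp only [Fin.val_natAdd, Fin.val_castAdd] at this
  omega

/-- The active coordinate of `x`, with the sign that `α` attaches to it. -/
def activeTerm {n D t K : ℕ} (k : Fin K) (r : Fin (2 ^ K) → Fin D)
    (w : Fin (2 ^ K) × Fin (2 ^ K)) (α : Fin (2 ^ K) → ℤˣ) (x : Grid n (D + t)) : ℤ :=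
  (α (slot k w x) : ℤ) * ((x (Fin.castAdd t (r (slot k w x))) : ℕ) : ℤ)

/-- `activeTerm`, with all signs reversed on side `1` of the grid. -/
def twistedTerm {n D t K : ℕ} (k : Fin K) (r : Fin (2 ^ K) → Fin D)
    (w : Fin (2 ^ K) × Fin (2 ^ K)) (α : Fin (2 ^ K) → ℤˣ) (x : Grid n (D + t)) : ℤ :=
  if selector x % 2 = 0 then activeTerm k r w α x else -activeTerm k r w α x

theorem abs_activeTerm_le {n D t K : ℕ} (k : Fin K) (r : Fin (2 ^ K) → Fin D)
    (w : Fin (2 ^ K) × Fin (2 ^ K)) (α : Fin (2 ^ K) → ℤˣ) (x : Grid n (D + t)) :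
    |activeTerm k r w α x| ≤ n := by
  have h := (x (Fin.castAdd t (r (slot k w x)))).2
  rw [activeTerm, abs_mul, Int.abs_eq_natAbs, Int.units_natAbs, Nat.cast_one, one_mul,
    Nat.abs_cast]
  exact_mod_cast h.le

theorem abs_twistedTerm_le {n D t K : ℕ} (k : Fin K) (r : Fin (2 ^ K) → Fin D)
    (w : Fin (2 ^ K) × Fin (2 ^ K)) (α : Fin (2 ^ K) → ℤˣ) (x : Grid n (D + t)) :
    |twistedTerm k r w α x| ≤ n := by
  rw [twistedTerm]
  split_ifs
  · exact abs_activeTerm_le k r w α x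
  · rw [abs_neg]
    exact abs_activeTerm_le k r w α x

/-- Along an action coordinate, the function is constant where another one is active and has the
fixed sign `α` elsewhere; along the other coordinates, `W` makes it increase. -/
theorem unate_noisy_activeTerm {n D t K : ℕ} (k : Fin K) {r : Fin (2 ^ K) → Fin D}
    (hr : Function.Injective r) (w : Fin (2 ^ K) × Fin (2 ^ K)) (α : Fin (2 ^ K) → ℤˣ)
    {B : ℕ} {W : ℤ} (hW : B + (2 * n : ℕ) ≤ W) (U : Grid n (D + t) → Fin B) :
    Unate (noisy W (fun x => ∑ c, ((forget (actionSet t r) x c : ℕ) : ℤ))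
      (forget (actionSet t r)) (activeTerm k r w α) U) := by
  intro c
  by_cases hc : c ∈ actionSet t r
  · obtain ⟨j, -, rfl⟩ := mem_image.1 hc
    have key : ∀ (x : Grid n (D + t)) (a : Fin n),
        activeTerm k r w α (Function.update x (Fin.castAdd t (r j)) a) =
          if slot k w x = j then (α j : ℤ) * ((a : ℕ) : ℤ) else activeTerm k r w α x := by
      intro x a
      have hs : slot k w (Function.update x (Fin.castAdd t (r j)) a) = slot k w x :=
        slot_congr (selector_update_castAdd x (r j) a)
      unfold activeTerm
      rw [hs]
      split_ifs with h
      · rw [h, Function.update_self]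
      · rw [Function.update_of_ne]
        exact fun h' => h (hr (Fin.castAdd_injective D t h'))
    have hnode : ∀ (x : Grid n (D + t)) (a : Fin n),
        forget (actionSet t r) (Function.update x (Fin.castAdd t (r j)) a) =
          forget (actionSet t r) x := fun x a => forget_update_of_mem hc a
    rcases Int.units_eq_one_or (α j) with hα | hα
    · refine Or.inl fun x a b hab => ?_
      refine (noisy_le_noisy_iff (by simp only [hnode]) (by simp only [hnode])).2 ?_
      rw [key, key, hα]
      split_ifs
      · simpa using hab
      · exact le_rfl
    · refine Or.inr fun x a b hab => ?_
      refine (noisy_le_noisy_iff (by simp only [hnode]) (by simp only [hnode])).2 ?_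
      rw [key, key, hα]
      split_ifs
      · simpa using hab
      · exact le_rfl
  · refine Or.inl fun x a b hab => ?_
    rcases hab.eq_or_lt with rfl | hlt
    · exact le_rfl
    refine (noisy_lt_of_lt hW ?_ ?_).le
    · have h₁ := abs_le.1 (abs_activeTerm_le k r w α (Function.update x c a))
      have h₂ := abs_le.1 (abs_activeTerm_le k r w α (Function.update x c b))
      push_cast
      omega
    · simp only [forget_update_of_notMem hc]
      exact sum_val_update_lt _ c hlt

theorem card_filter_val_lt_eq {M a : ℕ} (h : a ≤ M) : #{j : Fin M | (j : ℕ) < a} = a := by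
  have := Fin.card_filter_val_lt (n := M) (m := a)
  simpa [h] using this

theorem exists_add_mod_eq {b j : ℕ} (hj : j < b) (u : ℕ) : ∃ c < b, (c + u) % b = j := by
  refine ⟨(j + (b - 1) * u) % b, Nat.mod_lt _ (by omega), ?_⟩
  have : j + (b - 1) * u + u = j + b * u := by
    obtain ⟨b, rfl⟩ : ∃ b', b = b' + 1 := ⟨b - 1, by omega⟩
    simp only [Nat.add_sub_cancel]
    ring
  rw [Nat.mod_add_mod, this, Nat.add_mul_mod_self_left, Nat.mod_eq_of_lt hj]

/-- The parts of the grid have nearly equal size. -/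
theorem div_le_card_residue (m : ℕ) {a b j : ℕ} (hb : b < 2) (hj : j < 2 ^ a) (u : ℕ) :
    m / 2 ^ (a + 1) ≤ #{v : Fin m | (v : ℕ) % 2 = b ∧ ((v : ℕ) / 2 + u) % 2 ^ a = j} := by
  obtain ⟨c, hc, hcu⟩ := exists_add_mod_eq hj u
  have hv : ∀ s < m / 2 ^ (a + 1), 2 * (2 ^ a * s + c) + b < m := by
    intro s hs
    have h₁ : 2 ^ (a + 1) * (s + 1) ≤ m :=
      (Nat.mul_le_mul_left _ hs).trans (Nat.mul_div_le m _)
    have h₂ : 2 ^ (a + 1) * (s + 1) = 2 * (2 ^ a * s) + 2 * 2 ^ a := by ring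
    omega
  have hm : ∀ s : ℕ, (2 * (2 ^ a * s + c) + b) / 2 = 2 ^ a * s + c := by omega
  calc m / 2 ^ (a + 1) = #(range (m / 2 ^ (a + 1))) := (card_range _).symm
    _ ≤ #((univ.filter fun v : Fin m => (v : ℕ) % 2 = b ∧
          ((v : ℕ) / 2 + u) % 2 ^ a = j).map Fin.valEmbedding) := by
        refine card_le_card_of_injOn (fun s => 2 * (2 ^ a * s + c) + b) ?_ ?_
        · intro s hs
          have hs' := hv s (by simpa using hs)
          simp only [coe_map, Set.mem_image, coe_filter, mem_univ, true_and, Set.mem_ofPred_eq,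
            Fin.valEmbedding_apply]
          refine ⟨⟨_, hs'⟩, ⟨?_, ?_⟩, rfl⟩
          · simp only
            omega
          · simp only [hm]
            rw [add_assoc, Nat.mul_add_mod, hcu]
        · intro s _ s' _ hss'
          simp only at hss'
          have h : 2 ^ a * s = 2 ^ a * s' := by omega
          exact Nat.eq_of_mul_eq_mul_left (by positivity) h
    _ = _ := card_map _

/-- For each action coordinate, one of the two signs seen on the two sides is wrong for `g`; this
spoils a matching inside the parts of that side where the coordinate is active. -/
theorem farFromUnate_noisy_twistedTerm {n D t K : ℕ} (hn : 2 ≤ n) (ht : K + 2 ≤ t) (k : Fin K)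
    (r : Fin (2 ^ K) → Fin D) (w : Fin (2 ^ K) × Fin (2 ^ K))
    (α : Fin (2 ^ K) → ℤˣ) {B : ℕ} {W : ℤ} (U : Grid n (D + t) → Fin B) :
    FarFromUnate (1 / 8) (noisy W (fun x => ∑ c, ((forget (actionSet t r) x c : ℕ) : ℤ))
      (forget (actionSet t r)) (twistedTerm k r w α) U) := by
  refine farFromUnate_of_matching fun g hg => ?_
  set f := noisy W (fun x => ∑ c, ((forget (actionSet t r) x c : ℕ) : ℤ))
    (forget (actionSet t r)) (twistedTerm k r w α) U with hf
  let act : Grid n (D + t) → Fin (D + t) := fun x => Fin.castAdd t (r (slot k w x))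
  let φ : Grid n (D + t) → Grid n (D + t) := fun x => bitDown (act x) 0 x
  have hsel : ∀ x, selector (φ x) = selector x := fun x =>
    selector_update_castAdd x (r (slot k w x)) _
  have hslot : ∀ x, slot k w (φ x) = slot k w x := fun x => slot_congr (hsel x)
  have hact : ∀ x, act (φ x) = act x := fun x => by simp only [act, hslot]
  have hnode : ∀ x, forget (actionSet t r) (φ x) = forget (actionSet t r) x := fun x =>
    forget_update_of_mem (castAdd_mem_actionSet r _) _
  have hval : ∀ x, ((φ x (act x) : Fin n) : ℕ) = x (act x) - 1 := fun x => by
    simp [φ]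
  -- On side `b`, the functions `f` and `g` go in opposite directions along the coordinate `r j`.
  have hside : ∀ j : Fin (2 ^ K), ∃ b < 2, ∀ x, selector x % 2 = b → slot k w x = j →
      (x (act x) : ℕ) / 2 ^ 0 % 2 = 1 → f x = g x → f (φ x) ≠ g (φ x) := by
    intro j
    have hsign : ∀ s : ℤˣ, ∃ b < 2, ∀ y, selector y % 2 = b → slot k w y = j →
        twistedTerm k r w α y = (s : ℤ) * ((y (act y) : ℕ) : ℤ) := by
      intro s
      have hterm : ∀ y, slot k w y = j →
          activeTerm k r w α y = (α j : ℤ) * ((y (act y) : ℕ) : ℤ) := by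
        rintro y rfl
        rfl
      by_cases hs : s = α j
      · exact ⟨0, by omega, fun y hb hy => by rw [twistedTerm, if_pos hb, hterm y hy, hs]⟩
      · refine ⟨1, by omega, fun y hb hy => ?_⟩
        rw [twistedTerm, if_neg (by omega), hterm y hy, Int.units_ne_iff_eq_neg.1 hs]
        simp
    rcases hg (Fin.castAdd t (r j)) with hmono | hanti
    · obtain ⟨b, hb, hsgn⟩ := hsign (-1)
      refine ⟨b, hb, fun x hx hj hodd h₁ h₂ => ?_⟩
      have hle := le_of_monotone_bitDown hmono 0 x
      rw [← hj] at hle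
      change g (φ x) ≤ g x at hle
      rw [← h₁, ← h₂, noisy_le_noisy_iff (hnode x) (by rw [hnode]), hsgn x hx hj,
        hsgn (φ x) (by rw [hsel, hx]) (by rw [hslot, hj]), hact, hval] at hle
      rw [pow_zero, Nat.div_one] at hodd
      push_cast at hle
      omega
    · obtain ⟨b, hb, hsgn⟩ := hsign 1
      refine ⟨b, hb, fun x hx hj hodd h₁ h₂ => ?_⟩
      have hle := le_of_antitone_bitDown hanti 0 x
      rw [← hj] at hle
      change g x ≤ g (φ x) at hle
      rw [← h₁, ← h₂, noisy_le_noisy_iff (hnode x).symm (by rw [hnode]), hsgn x hx hj,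
        hsgn (φ x) (by rw [hsel, hx]) (by rw [hslot, hj]), hact, hval] at hle
      rw [pow_zero, Nat.div_one] at hodd
      push_cast at hle
      omega
  choose side hside2 hside using hside
  let P : Finset (Grid n (D + t)) :=
    {x | selector x % 2 = side (slot k w x) ∧ (x (act x) : ℕ) / 2 ^ 0 % 2 = 1}
  have hP : ∀ x, x ∈ P ↔ selector x % 2 = side (slot k w x) ∧ (x (act x) : ℕ) / 2 ^ 0 % 2 = 1 :=
    fun x => by simp [P]
  refine ⟨P, φ, ?_, ?_, ?_, ?_⟩
  · intro x hx y hy hxy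
    have hx' := (hP x).1 hx
    have hy' := (hP y).1 hy
    have ha : act x = act y := by rw [← hact x, hxy, hact y]
    rw [← ha] at hy'
    refine eq_of_bitDown_eq hx'.2 hy'.2 ?_
    simpa only [φ, ← ha] using hxy
  · intro x hx hx'
    have h₁ := ((hP _).1 hx).2
    have h₂ := ((hP _).1 hx').2
    rw [hact, hval] at h₂
    omega
  · intro x hx
    have hx' := (hP x).1 hx
    exact hside _ x hx'.1 rfl hx'.2
  · -- A part has about `n ^ (D + t) / 2 ^ (k + 1)` points, and at least a third of them have an odd
    -- active coordinate; since `n ^ t` exceeds `8 * 2 ^ k`, rounding costs little.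
    have hpow : 0 < 2 ^ (k : ℕ) := by positivity
    have hkK : 2 ^ (k : ℕ) ≤ 2 ^ K := Nat.pow_le_pow_right two_pos k.2.le
    -- The points of `P` at which the coordinate number `j` is active.
    have hpart : ∀ j : Fin (2 ^ K), (j : ℕ) < 2 ^ (k : ℕ) →
        n ^ D * (n ^ t / 2 ^ ((k : ℕ) + 1)) ≤ 3 * #{x ∈ P | slot k w x = j} := by
      intro j hj
      let A : Grid n (D + t) → Prop := fun x => selector x % 2 = side j ∧ slot k w x = j
      have hA : ∀ x (a : Fin n), A (Function.update x (Fin.castAdd t (r j)) a) ↔ A x := by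
        intro x a
        have h := selector_update_castAdd x (r j) a
        simp only [A, h, slot_congr (k := k) (w := w) h]
      classical
      have h₁ := card_filter_and_apply_mem A (Fin.castAdd t (r j)) hA
        {a : Fin n | (a : ℕ) / 2 ^ 0 % 2 = 1}
      have h₂ := le_two_mul_card_bit n 0
      have h₃ : #{x : Grid n (D + t) | A x ∧ x (Fin.castAdd t (r j)) ∈
          ({a : Fin n | (a : ℕ) / 2 ^ 0 % 2 = 1} : Finset (Fin n))} =
            #{x ∈ P | slot k w x = j} := by
        congr 1
        ext x
        simp only [mem_filter, mem_univ, true_and, hP, A, act]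
        constructor
        · rintro ⟨⟨h, rfl⟩, h'⟩
          exact ⟨⟨h, h'⟩, rfl⟩
        · rintro ⟨⟨h, h'⟩, rfl⟩
          exact ⟨⟨h, rfl⟩, h'⟩
      have h₄ : n ^ D * (n ^ t / 2 ^ ((k : ℕ) + 1)) ≤ #{x : Grid n (D + t) | A x} := by
        refine (Nat.mul_le_mul_left _ (div_le_card_residue (n ^ t) (hside2 j) hj
          (sideShift w (side j)))).trans ?_
        rw [← card_selector (fun v => v % 2 = side j ∧
          (v / 2 + sideShift w (side j)) % 2 ^ (k : ℕ) = j)]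
        refine card_le_card fun x hx => ?_
        simp only [mem_filter, mem_univ, true_and, A] at hx ⊢
        refine ⟨hx.1, Fin.ext ?_⟩
        simp only [slot, hx.1, hx.2]
      rw [h₃, Fintype.card_fin] at h₁
      refine h₄.trans (le_of_mul_le_mul_left (a := n) ?_ (by omega))
      rw [mul_left_comm, h₁, ← mul_assoc]
      exact Nat.mul_le_mul_right _ (by omega)
    have hsum : 2 ^ (k : ℕ) * (n ^ D * (n ^ t / 2 ^ ((k : ℕ) + 1))) ≤ 3 * #P := by
      calc 2 ^ (k : ℕ) * (n ^ D * (n ^ t / 2 ^ ((k : ℕ) + 1)))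
          = ∑ _j ∈ ({j : Fin (2 ^ K) | (j : ℕ) < 2 ^ (k : ℕ)} : Finset _),
              n ^ D * (n ^ t / 2 ^ ((k : ℕ) + 1)) := by
            rw [sum_const, card_filter_val_lt_eq hkK, smul_eq_mul]
        _ ≤ ∑ j ∈ ({j : Fin (2 ^ K) | (j : ℕ) < 2 ^ (k : ℕ)} : Finset _),
              3 * #{x ∈ P | slot k w x = j} :=
            sum_le_sum fun j hj => hpart j (by simpa using hj)
        _ = 3 * #P := by
            rw [← mul_sum, ← card_eq_sum_card_fiberwise]
            intro x _
            simp only [coe_filter, mem_univ, true_and, Set.mem_ofPred_eq, slot]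
            exact Nat.mod_lt _ hpow
    have hm : 8 * 2 ^ (k : ℕ) ≤ n ^ t := by
      calc 8 * 2 ^ (k : ℕ) = 2 ^ ((k : ℕ) + 3) := by rw [pow_add, mul_comm]; norm_num
        _ ≤ 2 ^ t := Nat.pow_le_pow_right two_pos (by have := k.2; omega)
        _ ≤ n ^ t := Nat.pow_le_pow_left hn t
    have hdiv : n ^ t < 2 * 2 ^ (k : ℕ) * (n ^ t / 2 ^ ((k : ℕ) + 1)) + 2 * 2 ^ (k : ℕ) := by
      have h := Nat.lt_mul_div_succ (n ^ t) (b := 2 ^ ((k : ℕ) + 1)) (by positivity)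
      rw [pow_succ, mul_comm (2 ^ (k : ℕ)) 2, mul_add, mul_one] at h
      rwa [pow_succ, mul_comm (2 ^ (k : ℕ)) 2]
    have hmain : 3 * n ^ t ≤ 8 * (2 ^ (k : ℕ) * (n ^ t / 2 ^ ((k : ℕ) + 1))) := by
      rw [mul_assoc] at hdiv
      omega
    have hfin := Nat.mul_le_mul_left (n ^ D) hmain
    have hcard : Fintype.card (Grid n (D + t)) = n ^ D * n ^ t := by
      simp [pow_add]
    rw [hcard]
    have e₁ : n ^ D * (3 * n ^ t) = 3 * (n ^ D * n ^ t) := by ring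
    have e₂ : n ^ D * (8 * (2 ^ (k : ℕ) * (n ^ t / 2 ^ ((k : ℕ) + 1)))) =
      8 * (2 ^ (k : ℕ) * (n ^ D * (n ^ t / 2 ^ ((k : ℕ) + 1)))) := by ring
    rw [e₁, e₂] at hfin
    omega

/-! ### The lower bound in the dimension -/

/-- The query set `Q` contains two points on side `b`, active at the coordinate number `j`, that
differ in this coordinate but in no coordinate outside the action set. -/
def Captured {n D t K : ℕ} (Q : Finset (Grid n (D + t))) (k : Fin K) (r : Fin (2 ^ K) → Fin D)
    (w : Fin (2 ^ K) × Fin (2 ^ K)) (b : ℕ) (j : Fin (2 ^ K)) : Prop :=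
  ∃ x ∈ Q, ∃ y ∈ Q, forget (actionSet t r) x = forget (actionSet t r) y ∧
    selector x % 2 = b ∧ slot k w x = j ∧ x (Fin.castAdd t (r j)) ≠ y (Fin.castAdd t (r j))

theorem selector_eq_of_forget_eq {n D t M : ℕ} {r : Fin M → Fin D} {x y : Grid n (D + t)}
    (h : forget (actionSet t r) x = forget (actionSet t r) y) : selector x = selector y :=
  selector_congr fun c => forget_eq_forget_iff.1 h _ (natAdd_notMem_actionSet r c)

open Classical in
/-- Reverse the signs of the action coordinates that are captured on side `1`. -/
noncomputable def flipCaptured {n D t K : ℕ} (Q : Finset (Grid n (D + t))) (k : Fin K)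
    (r : Fin (2 ^ K) → Fin D) (w : Fin (2 ^ K) × Fin (2 ^ K)) (α : Fin (2 ^ K) → ℤˣ) :
    Fin (2 ^ K) → ℤˣ :=
  fun j => if Captured Q k r w 1 j then -α j else α j

/-- If no action coordinate is captured on both sides, then `activeTerm` with signs `α` agrees with
`twistedTerm` with signs `flipCaptured α` wherever `Q` reveals a sign. -/
theorem activeTerm_sub_twistedTerm_eq {n D t K : ℕ} {Q : Finset (Grid n (D + t))} {k : Fin K}
    {r : Fin (2 ^ K) → Fin D} {w : Fin (2 ^ K) × Fin (2 ^ K)}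
    (hcap : ∀ j, Captured Q k r w 0 j → ¬ Captured Q k r w 1 j) (α : Fin (2 ^ K) → ℤˣ)
    {x y : Grid n (D + t)} (hx : x ∈ Q) (hy : y ∈ Q)
    (hxy : forget (actionSet t r) x = forget (actionSet t r) y) :
    activeTerm k r w α x - twistedTerm k r w (flipCaptured Q k r w α) x =
      activeTerm k r w α y - twistedTerm k r w (flipCaptured Q k r w α) y := by
  have hsel := selector_eq_of_forget_eq hxy
  have hslot : slot k w x = slot k w y := slot_congr hsel
  by_cases hne : x (Fin.castAdd t (r (slot k w x))) = y (Fin.castAdd t (r (slot k w x)))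
  · have h : ∀ β, activeTerm k r w β x = activeTerm k r w β y := fun β => by
      simp only [activeTerm, ← hslot, hne]
    simp only [twistedTerm, h, hsel]
  · have hzero : ∀ z : Grid n (D + t), selector z = selector x →
        activeTerm k r w α z - twistedTerm k r w (flipCaptured Q k r w α) z = 0 := by
      intro z hz
      have hzs : slot k w z = slot k w x := slot_congr hz
      have hcx : ∀ b, selector x % 2 = b → Captured Q k r w b (slot k w x) :=
        fun b hb => ⟨x, hx, y, hy, hxy, hb, rfl, hne⟩
      by_cases hb : selector x % 2 = 0
      · have h := hcap _ (hcx 0 hb)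
        simp [twistedTerm, activeTerm, flipCaptured, hz, hzs, hb, h]
      · have h := hcx 1 (by omega)
        simp [twistedTerm, activeTerm, flipCaptured, hz, hzs, hb, h]
    rw [hzero x rfl, hzero y hsel.symm]

theorem card_shift_le {m a j c : ℕ} : #{u : Fin (2 ^ (a + m)) | (c + (u : ℕ)) % 2 ^ a = j} ≤
    2 ^ m := by
  have hpos : 0 < 2 ^ a := by positivity
  refine (card_le_card_of_injOn (t := range (2 ^ m))
    (fun u : Fin (2 ^ (a + m)) => (u : ℕ) / 2 ^ a) ?_ ?_).trans (card_range _).le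
  · intro u _
    have h : (u : ℕ) < 2 ^ a * 2 ^ m := u.2.trans_eq (pow_add 2 a m)
    simpa using Nat.div_lt_of_lt_mul h
  · intro u hu v hv huv
    simp only [coe_filter, mem_univ, true_and, Set.mem_ofPred_eq] at hu hv huv
    have h₁ : (u : ℕ) ≡ v [MOD 2 ^ a] :=
      Nat.ModEq.add_left_cancel' c (hu.trans hv.symm)
    ext
    rw [← Nat.div_add_mod (u : ℕ) (2 ^ a), ← Nat.div_add_mod (v : ℕ) (2 ^ a), huv, h₁]

/-- Forget the coordinates in `S` and all coordinates before the `i`-th one. -/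
def forgetBelow {n m : ℕ} (S : Finset (Fin m)) (i : ℕ) (x : Grid n m) : Grid n m :=
  forget (S ∪ univ.filter fun c => (c : ℕ) < i) x

theorem forgetBelow_eq_iff {n m : ℕ} {S : Finset (Fin m)} {i : ℕ} {x y : Grid n m} :
    forgetBelow S i x = forgetBelow S i y ↔ ∀ c ∉ S, i ≤ (c : ℕ) → x c = y c := by
  unfold forgetBelow
  rw [forget_eq_forget_iff]
  simp only [mem_union, mem_filter, mem_univ, true_and, not_or, not_lt, and_imp]

theorem selector_forgetBelow {n D t : ℕ} {S : Finset (Fin (D + t))}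
    (hS : ∀ c : Fin t, Fin.natAdd D c ∉ S) {i : ℕ} (hi : i ≤ D) (x : Grid n (D + t)) :
    selector (forgetBelow S i x) = selector x := by
  refine selector_congr fun c => forget_apply_of_notMem ?_
  simp only [mem_union, mem_filter, mem_univ, true_and, not_or, not_lt, Fin.val_natAdd]
  exact ⟨hS c, by omega⟩

/-- How much the partition of `Q` by the coordinates outside `S` and above the `i`-th one is refined
when the `i`-th coordinate is added. This bounds the number of its classes that vary along `i`. -/
def splits {n m : ℕ} (Q : Finset (Grid n m)) (S : Finset (Fin m)) (i : ℕ) : ℕ :=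
  #(Q.image (forgetBelow S i)) - #(Q.image (forgetBelow S (i + 1)))

theorem card_add_card_image_forgetBelow_le {n m : ℕ} (Q : Finset (Grid n m))
    (S : Finset (Fin m)) (i : ℕ) (B : Finset (Grid n m))
    (hB : ∀ c ∈ B, ∃ x ∈ Q, ∃ y ∈ Q, forgetBelow S (i + 1) x = c ∧ forgetBelow S (i + 1) y = c ∧
      forgetBelow S i x ≠ forgetBelow S i y) :
    #B + #(Q.image (forgetBelow S (i + 1))) ≤ #(Q.image (forgetBelow S i)) := by
  refine card_branching_add_card_image_le Q _ _ (fun x y hxy => ?_) B hB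
  rw [forgetBelow_eq_iff] at hxy ⊢
  exact fun c hc hic => hxy c hc (by omega)

theorem sum_splits_le {n m : ℕ} (Q : Finset (Grid n m)) (S : Finset (Fin m)) (D : ℕ) :
    ∑ i ∈ range D, splits Q S i ≤ #Q := by
  have h := sum_range_add_le (u := splits Q S) (a := fun i => #(Q.image (forgetBelow S i)))
    (m := D) fun i _ => by
      have := card_add_card_image_forgetBelow_le Q S i ∅ (by simp)
      simp only [splits]
      omega
  exact (Nat.le_add_right _ _).trans (h.trans card_image_le)

open Classical in
/-- Given the other action coordinates `S` and the `j`-th one `i`, the number of shifts of side `b`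
for which the `j`-th action coordinate is captured there. Each class that varies along `i` lies in
one part, and a part is matched with `j` by a fraction `2 ^ (-k)` of all shifts. -/
theorem card_shift_captured_le {n D t K : ℕ} (Q : Finset (Grid n (D + t))) {k : ℕ} (hk : k ≤ K)
    {S R : Finset (Fin (D + t))} {i : Fin D} (hS : ∀ c : Fin t, Fin.natAdd D c ∉ S)
    (hi : Fin.castAdd t i ∉ S) (hR : R ⊆ insert (Fin.castAdd t i) S) (b j : ℕ) :
    #{u : Fin (2 ^ K) | ∃ x ∈ Q, ∃ y ∈ Q, forget R x = forget R y ∧ selector x % 2 = b ∧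
        (selector x / 2 + (u : ℕ)) % 2 ^ k = j ∧
          x (Fin.castAdd t i) ≠ y (Fin.castAdd t i)} ≤
      min (splits Q S i) (2 ^ k) * 2 ^ (K - k) := by
  set B : Finset (Grid n (D + t)) := (Q.image (forgetBelow S (i + 1))).filter fun c =>
    ∃ x ∈ Q, ∃ y ∈ Q, forgetBelow S (i + 1) x = c ∧ forgetBelow S (i + 1) y = c ∧
      forgetBelow S i x ≠ forgetBelow S i y
  set Y : Finset ℕ := B.image fun v => selector v / 2 % 2 ^ k
  have hBs : #B ≤ splits Q S i := by
    have := card_add_card_image_forgetBelow_le Q S i B fun c hc => (mem_filter.1 hc).2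
    unfold splits
    omega
  have hYc : #Y ≤ min (splits Q S i) (2 ^ k) := by
    refine le_min (card_image_le.trans hBs) ?_
    refine (card_le_card (t := range (2 ^ k)) fun z hz => ?_).trans (card_range _).le
    obtain ⟨v, -, rfl⟩ := mem_image.1 hz
    exact mem_range.2 (Nat.mod_lt _ (by positivity))
  calc _ ≤ #(Y.biUnion fun z => ({u : Fin (2 ^ K) | (z + (u : ℕ)) % 2 ^ k = j} : Finset _)) := by
        refine card_le_card fun u hu => ?_
        simp only [mem_filter, mem_univ, true_and] at hu
        obtain ⟨x, hx, y, hy, hxy, -, hj, hne⟩ := hu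
        have hlow : ∀ c ∉ S, (i : ℕ) + 1 ≤ (c : ℕ) → x c = y c := fun c hc hic => by
          refine forget_eq_forget_iff.1 hxy c fun hcR => ?_
          rcases mem_insert.1 (hR hcR) with rfl | h
          · simp at hic
          · exact hc h
        have hmem : forgetBelow S (i + 1) x ∈ B := by
          refine mem_filter.2 ⟨mem_image_of_mem _ hx, x, hx, y, hy, rfl,
            (forgetBelow_eq_iff.2 hlow).symm, fun h => hne ?_⟩
          exact forgetBelow_eq_iff.1 h _ hi (by simp)
        refine mem_biUnion.2 ⟨selector x / 2 % 2 ^ k, mem_image.2 ⟨_, hmem, ?_⟩, ?_⟩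
        · rw [selector_forgetBelow hS i.2]
        · simp only [mem_filter, mem_univ, true_and]
          rw [Nat.mod_add_mod, hj]
    _ ≤ ∑ z ∈ Y, 2 ^ (K - k) := by
        refine card_biUnion_le.trans (sum_le_sum fun z _ => ?_)
        obtain ⟨m, rfl⟩ := Nat.exists_eq_add_of_le hk
        rw [Nat.add_sub_cancel_left]
        exact card_shift_le
    _ ≤ _ := by
        rw [sum_const, smul_eq_mul]
        exact Nat.mul_le_mul_right _ hYc

/-- The action coordinates other than the one with number `j`. -/
def otherActions {D M : ℕ} (t : ℕ) (r : Fin M → Fin D) (j : Fin M) : Finset (Fin (D + t)) :=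
  (univ.erase j).image fun j' => Fin.castAdd t (r j')

open Classical in
/-- Given the action coordinates `r₀` except for the `j`-th one, the number of pairs of shifts for
which the choice `i` for the latter is captured on both sides. -/
theorem card_captured_both_le {n D t K : ℕ} (Q : Finset (Grid n (D + t))) (k : Fin K)
    (j : Fin (2 ^ K)) (r₀ : Fin (2 ^ K) → Fin D) (i : Fin D) :
    #{w : Fin (2 ^ K) × Fin (2 ^ K) | Function.Injective (Function.update r₀ j i) ∧
        Captured Q k (Function.update r₀ j i) w 0 j ∧
          Captured Q k (Function.update r₀ j i) w 1 j} ≤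
      (min (splits Q (otherActions t r₀ j) i) (2 ^ (k : ℕ)) * 2 ^ (K - k)) ^ 2 := by
  set r := Function.update r₀ j i with hr
  have hrj : r j = i := by simp [hr]
  by_cases hinj : Function.Injective r
  swap
  · simp [hinj]
  have hS : ∀ c : Fin t, Fin.natAdd D c ∉ otherActions t r₀ j := by
    intro c hc
    obtain ⟨j', -, hj'⟩ := mem_image.1 hc
    have := congrArg Fin.val hj'
    simp only [Fin.val_natAdd, Fin.val_castAdd] at this
    omega
  have hne : ∀ j' ≠ j, r j' = r₀ j' := fun j' h => Function.update_of_ne h _ _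
  have hi : Fin.castAdd t i ∉ otherActions t r₀ j := by
    intro hc
    obtain ⟨j', hj'j, hj'⟩ := mem_image.1 hc
    have hj'j := (mem_erase.1 hj'j).1
    refine hj'j (hinj ?_)
    rw [hne j' hj'j, hrj]
    exact Fin.castAdd_injective D t hj'
  have hR : actionSet t r ⊆ insert (Fin.castAdd t i) (otherActions t r₀ j) := by
    intro c hc
    obtain ⟨j', -, rfl⟩ := mem_image.1 hc
    by_cases h : j' = j
    · rw [h, hrj]
      exact mem_insert_self _ _
    · refine mem_insert_of_mem (mem_image.2 ⟨j', mem_erase.2 ⟨h, mem_univ _⟩, ?_⟩)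
      rw [hne j' h]
  have hside := card_shift_captured_le Q k.2.le hS hi hR
  refine le_trans (card_le_card fun w hw => ?_) ((card_product
    ({u : Fin (2 ^ K) | ∃ x ∈ Q, ∃ y ∈ Q, forget (actionSet t r) x = forget (actionSet t r) y ∧
      selector x % 2 = 0 ∧ (selector x / 2 + (u : ℕ)) % 2 ^ (k : ℕ) = j ∧
        x (Fin.castAdd t i) ≠ y (Fin.castAdd t i)} : Finset (Fin (2 ^ K)))
    ({u : Fin (2 ^ K) | ∃ x ∈ Q, ∃ y ∈ Q, forget (actionSet t r) x = forget (actionSet t r) y ∧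
      selector x % 2 = 1 ∧ (selector x / 2 + (u : ℕ)) % 2 ^ (k : ℕ) = j ∧
        x (Fin.castAdd t i) ≠ y (Fin.castAdd t i)} : Finset (Fin (2 ^ K)))).le.trans ?_)
  · simp only [mem_filter, mem_univ, true_and, mem_product] at hw ⊢
    obtain ⟨-, ⟨x, hx, y, hy, h₁, h₂, h₃, h₄⟩, ⟨x', hx', y', hy', h₁', h₂', h₃', h₄'⟩⟩ := hw
    rw [hrj] at h₄ h₄'
    have h₃ := congrArg Fin.val h₃
    have h₃' := congrArg Fin.val h₃'
    simp only [slot, sideShift, h₂, h₂'] at h₃ h₃'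
    exact ⟨⟨x, hx, y, hy, h₁, h₂, by simpa using h₃, h₄⟩,
      ⟨x', hx', y', hy', h₁', h₂', by simpa using h₃', h₄'⟩⟩
  · rw [sq]
    exact Nat.mul_le_mul (hside 0 j) (hside 1 j)

/-- The scales `2 ^ k` much smaller and much larger than `a` contribute little: this is
`∑ k < K, min a (2 ^ k) ^ 2 / 2 ^ k ≤ 4 * a` without denominators. -/
theorem sum_scales_le (a K : ℕ) :
    ∑ k ∈ range K, 2 ^ k * (min a (2 ^ k) * 2 ^ (K - k)) ^ 2 ≤ 4 * (2 ^ K * 2 ^ K) * a := by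
  have key : (2 ^ K ≤ a → ∑ k ∈ range K, 2 ^ k * (min a (2 ^ k) * 2 ^ (K - k)) ^ 2 ≤
        2 ^ K * (2 ^ K * 2 ^ K)) ∧
      (a < 2 ^ K → ∑ k ∈ range K, 2 ^ k * (min a (2 ^ k) * 2 ^ (K - k)) ^ 2 + 2 * a ^ 2 * 2 ^ K ≤
        4 * (2 ^ K * 2 ^ K) * a) := by
    induction K with
    | zero =>
      refine ⟨fun _ => by simp, fun h => ?_⟩
      have : a = 0 := by simpa using h
      simp [this]
    | succ K ih =>
      have hstep : ∑ k ∈ range (K + 1), 2 ^ k * (min a (2 ^ k) * 2 ^ (K + 1 - k)) ^ 2 =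
          4 * ∑ k ∈ range K, 2 ^ k * (min a (2 ^ k) * 2 ^ (K - k)) ^ 2 +
            2 ^ K * (min a (2 ^ K) * 2) ^ 2 := by
        rw [sum_range_succ, mul_sum]
        congr 1
        · refine sum_congr rfl fun k hk => ?_
          rw [Nat.sub_add_comm (mem_range.1 hk).le, pow_succ]
          ring
        · rw [Nat.add_sub_cancel_left, pow_one]
      rw [hstep]
      set s := ∑ k ∈ range K, 2 ^ k * (min a (2 ^ k) * 2 ^ (K - k)) ^ 2
      have hp : 2 ^ (K + 1) = 2 * 2 ^ K := by ring
      rw [hp]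
      generalize 2 ^ K = p at ih ⊢
      -- The scales up to `a` form a geometric sum. The term `2 * a ^ 2 * 2 ^ K` of the second
      -- claim makes room for the scales beyond `a`, which decay geometrically.
      refine ⟨fun h => ?_, fun h => ?_⟩
      · rw [min_eq_right (by omega)]
        have := ih.1 (by omega)
        nlinarith
      · rcases le_or_gt p a with hpa | hpa
        · rw [min_eq_right hpa]
          have h₁ := ih.1 hpa
          have h₂ : 0 ≤ ((a : ℤ) - p) * (2 * p - a) * p := by
            refine mul_nonneg (mul_nonneg ?_ ?_) ?_ <;> omega
          have h₃ : 0 ≤ ((a : ℤ) - p) * p * p := by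
            refine mul_nonneg (mul_nonneg ?_ ?_) ?_ <;> omega
          zify at h₁ ⊢
          nlinarith
        · rw [min_eq_left hpa.le]
          have h₁ := ih.2 hpa
          nlinarith
  rcases le_or_gt (2 ^ K) a with h | h
  · refine (key.1 h).trans ?_
    nlinarith [Nat.mul_le_mul_right (2 ^ K * 2 ^ K) h, Nat.zero_le (a * (2 ^ K * 2 ^ K))]
  · exact (Nat.le_add_right _ _).trans (key.2 h)

/-- By symmetry, the law of the other action coordinates does not depend on `j`. -/
theorem sum_otherActions_eq {D M t : ℕ} (F : Finset (Fin (D + t)) → ℕ) (j j' : Fin M) :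
    ∑ r : Fin M → Fin D, F (otherActions t r j) = ∑ r : Fin M → Fin D, F (otherActions t r j') := by
  classical
  let e : Equiv.Perm (Fin M → Fin D) :=
    Equiv.arrowCongr (Equiv.swap j j') (Equiv.refl _)
  rw [← Equiv.sum_comp e]
  refine sum_congr rfl fun r _ => congrArg F ?_
  ext c
  simp only [otherActions, mem_image, mem_erase, mem_univ, and_true, e]
  constructor
  · rintro ⟨l, hl, rfl⟩
    refine ⟨Equiv.swap j j' l, fun h => hl ?_, by simp⟩
    exact (Equiv.swap j j').injective (h.trans (Equiv.swap_apply_left j j').symm)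
  · rintro ⟨l, hl, rfl⟩
    refine ⟨Equiv.swap j j' l, fun h => hl ?_, by simp⟩
    exact (Equiv.swap j j').injective (h.trans (Equiv.swap_apply_right j j').symm)

/-- If `M` is at most of order `√D`, then at least half of all functions `Fin M → Fin D` are
injective. -/
theorem pow_le_two_mul_card_embedding {M D : ℕ} (h : 2 * M ^ 2 ≤ D) :
    D ^ M ≤ 2 * Fintype.card (Fin M ↪ Fin D) := by
  rw [Fintype.card_embedding_eq, Fintype.card_fin, Fintype.card_fin]
  rcases Nat.eq_zero_or_pos M with rfl | hM
  · simp
  have hMD : M ≤ D := by nlinarith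
  have hD : (0 : ℝ) < D := by
    have : 0 < D := by omega
    exact_mod_cast this
  have h₁ := Nat.pow_sub_le_descFactorial D M
  have h₂ : (D - M) ^ M ≤ D.descFactorial M :=
    (Nat.pow_le_pow_left (by omega) M).trans h₁
  have h₃ : (1 : ℝ) / 2 ≤ (1 - M / D) ^ M := by
    have hb := one_add_mul_le_pow (a := -((M : ℝ) / D)) (by
      have : (M : ℝ) / D ≤ 1 := div_le_one_of_le₀ (by exact_mod_cast hMD) hD.le
      linarith) M
    have h₄ : (M : ℝ) * (M / D) ≤ 1 / 2 := by
      rw [← mul_div_assoc, div_le_iff₀ hD]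
      have : (2 * (M : ℝ) ^ 2) ≤ D := by exact_mod_cast h
      linarith
    rw [← sub_eq_add_neg] at hb
    linarith
  have h₅ : ((D - M : ℕ) : ℝ) = D * (1 - M / D) := by
    rw [Nat.cast_sub hMD]
    field_simp
  have h₆ : (D : ℝ) ^ M ≤ 2 * ((D - M : ℕ) : ℝ) ^ M := by
    rw [h₅, mul_pow]
    have : (0 : ℝ) < (D : ℝ) ^ M := by positivity
    nlinarith
  have h₇ : D ^ M ≤ 2 * (D - M) ^ M := by exact_mod_cast h₆
  omega

/-- The random data of the second hard distribution, apart from the signs: the scale `k`, the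
action coordinates, and the shifts on the two sides. -/
abbrev Layout (K D : ℕ) : Type :=
  Fin K × (Fin (2 ^ K) ↪ Fin D) × (Fin (2 ^ K) × Fin (2 ^ K))

open Classical in
/-- The layouts for which some action coordinate is captured on both sides. -/
noncomputable def badLayouts {n D t : ℕ} (K : ℕ) (Q : Finset (Grid n (D + t))) : Finset (Layout K D) :=
  {l | ∃ j, Captured Q l.1 l.2.1 l.2.2 0 j ∧ Captured Q l.1 l.2.1 l.2.2 1 j}

/-- The number of bad layouts is at most a fraction of order `#Q / (K * D)` of all layouts.
Injectivity of the choice of action coordinates is dropped in the union bound over `j`, so that the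
`j`-th one can be averaged with the others fixed. -/
theorem card_badLayouts_le {n D t K : ℕ} (Q : Finset (Grid n (D + t))) :
    D * #(badLayouts K Q) ≤ D ^ 2 ^ K * (4 * (2 ^ K * 2 ^ K) * #Q) := by
  classical
  let j₀ : Fin (2 ^ K) := ⟨0, by positivity⟩
  let N : Fin K → Fin (2 ^ K) → ℕ := fun k j => ∑ r : Fin (2 ^ K) → Fin D,
    #{w : Fin (2 ^ K) × Fin (2 ^ K) | Function.Injective r ∧ Captured Q k r w 0 j ∧
      Captured Q k r w 1 j}
  let G : Fin K → Finset (Fin (D + t)) → ℕ := fun k S =>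
    ∑ i : Fin D, (min (splits Q S i) (2 ^ (k : ℕ)) * 2 ^ (K - k)) ^ 2
  have hN : ∀ k j, D * N k j ≤ ∑ r : Fin (2 ^ K) → Fin D, G k (otherActions t r j₀) := by
    intro k j
    have h := sum_sum_update (fun r : Fin (2 ^ K) → Fin D =>
      #{w : Fin (2 ^ K) × Fin (2 ^ K) | Function.Injective r ∧ Captured Q k r w 0 j ∧
        Captured Q k r w 1 j}) j
    rw [Fintype.card_fin] at h
    rw [← sum_otherActions_eq (G k) j j₀, ← h]
    exact sum_le_sum fun r _ => sum_le_sum fun i _ => card_captured_both_le Q k j r i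
  have hbad : #(badLayouts K Q) ≤
      ∑ k : Fin K, ∑ j ∈ ({j : Fin (2 ^ K) | (j : ℕ) < 2 ^ (k : ℕ)} : Finset _), N k j := by
    have hslot : ∀ (k : Fin K) (r : Fin (2 ^ K) → Fin D) w j,
        Captured Q k r w 0 j → (j : ℕ) < 2 ^ (k : ℕ) := by
      rintro k r w j ⟨x, -, y, -, -, -, rfl, -⟩
      exact Nat.mod_lt _ (by positivity)
    calc #(badLayouts K Q)
        = ∑ k : Fin K, ∑ r : Fin (2 ^ K) ↪ Fin D, #{w : Fin (2 ^ K) × Fin (2 ^ K) |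
            ∃ j, Captured Q k r w 0 j ∧ Captured Q k r w 1 j} := by
          simp only [badLayouts, card_filter]
          rw [Fintype.sum_prod_type]
          exact sum_congr rfl fun k _ => Fintype.sum_prod_type _
      _ ≤ ∑ k : Fin K, ∑ r : Fin (2 ^ K) ↪ Fin D,
            ∑ j ∈ ({j : Fin (2 ^ K) | (j : ℕ) < 2 ^ (k : ℕ)} : Finset _),
              #{w : Fin (2 ^ K) × Fin (2 ^ K) | Function.Injective r ∧
                Captured Q k r w 0 j ∧ Captured Q k r w 1 j} := by
          refine sum_le_sum fun k _ => sum_le_sum fun r _ => ?_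
          refine (card_le_card fun w hw => ?_).trans card_biUnion_le
          simp only [mem_filter, mem_univ, true_and, mem_biUnion] at hw ⊢
          obtain ⟨j, h₀, h₁⟩ := hw
          exact ⟨j, hslot _ _ _ _ h₀, r.injective, h₀, h₁⟩
      _ ≤ _ := by
          refine sum_le_sum fun k _ => ?_
          rw [sum_comm]
          refine sum_le_sum fun j _ => ?_
          refine (sum_map univ ⟨fun r : Fin (2 ^ K) ↪ Fin D => (r : Fin (2 ^ K) → Fin D),
            DFunLike.coe_injective⟩ (fun r => #{w : Fin (2 ^ K) × Fin (2 ^ K) |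
              Function.Injective r ∧ Captured Q k r w 0 j ∧ Captured Q k r w 1 j})).ge.trans ?_
          exact sum_le_sum_of_subset (subset_univ _)
  calc D * #(badLayouts K Q)
      ≤ ∑ k : Fin K, ∑ j ∈ ({j : Fin (2 ^ K) | (j : ℕ) < 2 ^ (k : ℕ)} : Finset _),
          D * N k j := by
        simp only [← mul_sum]
        exact Nat.mul_le_mul_left _ hbad
    _ ≤ ∑ k : Fin K, ∑ _j ∈ ({j : Fin (2 ^ K) | (j : ℕ) < 2 ^ (k : ℕ)} : Finset _),
          ∑ r : Fin (2 ^ K) → Fin D, G k (otherActions t r j₀) :=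
        sum_le_sum fun k _ => sum_le_sum fun j _ => hN k j
    _ = ∑ k : Fin K, 2 ^ (k : ℕ) * ∑ r : Fin (2 ^ K) → Fin D, G k (otherActions t r j₀) := by
        refine sum_congr rfl fun k _ => ?_
        rw [sum_const, card_filter_val_lt_eq (Nat.pow_le_pow_right two_pos k.2.le), smul_eq_mul]
    _ = ∑ r : Fin (2 ^ K) → Fin D, ∑ i : Fin D, ∑ k ∈ range K, 2 ^ k *
          (min (splits Q (otherActions t r j₀) i) (2 ^ k) * 2 ^ (K - k)) ^ 2 := by
        simp only [mul_sum, G]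
        rw [sum_comm]
        refine sum_congr rfl fun r _ => ?_
        rw [sum_comm]
        refine sum_congr rfl fun i _ => ?_
        rw [Finset.sum_range]
    _ ≤ ∑ r : Fin (2 ^ K) → Fin D, ∑ i : Fin D,
          4 * (2 ^ K * 2 ^ K) * splits Q (otherActions t r j₀) i :=
        sum_le_sum fun r _ => sum_le_sum fun i _ => sum_scales_le _ _
    _ ≤ ∑ _r : Fin (2 ^ K) → Fin D, 4 * (2 ^ K * 2 ^ K) * #Q := by
        refine sum_le_sum fun r _ => ?_
        rw [← mul_sum]
        refine Nat.mul_le_mul_left _ ?_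
        rw [← Finset.sum_range (splits Q (otherActions t r j₀))]
        exact sum_splits_le Q _ D
    _ = _ := by simp

/-- The part of the lower bound that comes from the number of coordinates. -/
theorem lt_mul_of_isUnatenessTester {n D t K q : ℕ} (hn : 2 ≤ n) (hK : 1 ≤ K)
    (hD : 2 * (2 ^ K) ^ 2 ≤ D) (ht : K + 2 ≤ t) {ε : ℝ} (hε : ε ≤ 1 / 8) {Ω : Type*}
    [MeasurableSpace Ω] (μ : Measure Ω) [IsProbabilityMeasure μ]
    (T : NonadaptiveAlgorithm (Grid n (D + t)) Ω) (hT : T.IsUnatenessTester μ ε)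
    (hTq : T.MakesAtMost q) : K * D < 32 * q := by
  classical
  by_contra! hq
  have hpos : 0 < 2 ^ K := by positivity
  have hDpos : 0 < D := by nlinarith
  have hMD : 2 ^ K ≤ D := by nlinarith
  have : Nonempty (Layout K D) :=
    ⟨⟨⟨0, hK⟩, Fin.castLEEmb hMD, ⟨0, hpos⟩, ⟨0, hpos⟩⟩⟩
  refine not_isUnatenessTester_of_hidden (J := Layout K D × (Fin (2 ^ K) → ℤˣ)) (C := 2 * n)
    (q := q)
    (fun p x => ∑ c, ((forget (actionSet t p.1.2.1) x c : ℕ) : ℤ))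
    (fun p => forget (actionSet t p.1.2.1))
    (fun p => activeTerm p.1.1 p.1.2.1 p.1.2.2 p.2)
    (fun p => twistedTerm p.1.1 p.1.2.1 p.1.2.2 p.2)
    (fun B W hW p U => unate_noisy_activeTerm p.1.1 p.1.2.1.injective p.1.2.2 p.2 hW U)
    (fun B W _ p U => farFromUnate_noisy_twistedTerm hn ht p.1.1 p.1.2.1 p.1.2.2 p.2 U)
    (fun p p' x => ?_) (fun Q hQ => ?_) hε μ T hTq hT
  · have h₁ := abs_le.1 (abs_activeTerm_le p.1.1 p.1.2.1 p.1.2.2 p.2 x)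
    have h₂ := abs_le.1 (abs_twistedTerm_le p'.1.1 p'.1.2.1 p'.1.2.2 p'.2 x)
    rw [abs_le]
    push_cast
    omega
  · have hinv : Function.Involutive fun p : Layout K D × (Fin (2 ^ K) → ℤˣ) =>
        (p.1, flipCaptured Q p.1.1 p.1.2.1 p.1.2.2 p.2) := by
      rintro ⟨l, α⟩
      refine Prod.ext rfl (funext fun j => ?_)
      simp only [flipCaptured]
      split_ifs <;> simp
    refine ⟨hinv.toPerm, badLayouts K Q ×ˢ univ, ?_, fun p hp => ⟨rfl, rfl, ?_⟩⟩
    · rw [card_product, Fintype.card_prod, card_univ, ← mul_assoc]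
      refine Nat.mul_le_mul_right _ ?_
      have h₁ := card_badLayouts_le (K := K) Q
      have h₂ := pow_le_two_mul_card_embedding hD
      set E := Fintype.card (Fin (2 ^ K) ↪ Fin D)
      have hcard : Fintype.card (Layout K D) = K * (E * (2 ^ K * 2 ^ K)) := by
        simp [E]
      rw [hcard]
      refine le_of_mul_le_mul_left (a := D) ?_ hDpos
      have h₃ : D * #(badLayouts K Q) ≤ (2 * E) * (4 * (2 ^ K * 2 ^ K) * q) :=
        h₁.trans (Nat.mul_le_mul h₂ (Nat.mul_le_mul_left _ hQ))
      calc D * (4 * #(badLayouts K Q)) = 4 * (D * #(badLayouts K Q)) := by ring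
        _ ≤ 4 * ((2 * E) * (4 * (2 ^ K * 2 ^ K) * q)) := Nat.mul_le_mul_left _ h₃
        _ = (E * (2 ^ K * 2 ^ K)) * (32 * q) := by ring
        _ ≤ (E * (2 ^ K * 2 ^ K)) * (K * D) := by gcongr
        _ = _ := by ring
    · intro x hx y hy hxy
      have hp' : p.1 ∉ badLayouts K Q := fun h => hp (mem_product.2 ⟨h, mem_univ _⟩)
      simp only [badLayouts, mem_filter, mem_univ, true_and, not_exists, not_and] at hp'
      exact activeTerm_sub_twistedTerm_eq hp' p.2 hx hy hxy

/-! ### Logarithmic form of the bounds -/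

/-- The parity of two coordinates of the hypercube is far from unate. -/
theorem farFromUnate_xor {d : ℕ} {i j : Fin d} (hij : j ≠ i) :
    FarFromUnate (1 / 8) fun x : Grid 2 d => if x i = x j then (0 : ℝ) else 1 := by
  have hcard : ∀ a : Fin 2, Fintype.card (Grid 2 d) ≤ 8 * #{x : Grid 2 d | x j = a ∧ x i = 1} := by
    intro a
    have h₁ : Fintype.card (Fin 2) * #{x : Grid 2 d | x j = a ∧ x i ∈ ({1} : Finset (Fin 2))} =
        #({1} : Finset (Fin 2)) * #{x : Grid 2 d | x j = a} :=
      card_filter_and_apply_mem (fun x : Grid 2 d => x j = a) i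
        (fun x t => by simp [Function.update_of_ne hij]) {1}
    have h₂ : Fintype.card (Fin 2) * #{x : Grid 2 d | True ∧ x j ∈ ({a} : Finset (Fin 2))} =
        #({a} : Finset (Fin 2)) * #{x : Grid 2 d | True} :=
      card_filter_and_apply_mem (fun _ : Grid 2 d => True) j (fun _ _ => Iff.rfl) {a}
    simp only [mem_singleton, true_and, Fintype.card_fin, card_singleton, filter_true,
      card_univ] at h₁ h₂
    omega
  have hdown : ∀ x : Grid 2 d, x i = 1 → bitDown i 0 x i = 0 := fun x hx => by
    ext
    simp [hx]
  have hj : ∀ x : Grid 2 d, bitDown i 0 x j = x j := fun x => bitDown_apply_of_ne hij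
  have hinj : ∀ a : Fin 2, Set.InjOn (bitDown i 0)
      (({x | x j = a ∧ x i = 1} : Finset (Grid 2 d)) : Set (Grid 2 d)) := by
    intro a x hx y hy hxy
    simp only [coe_filter, mem_univ, true_and, Set.mem_ofPred_eq] at hx hy
    exact eq_of_bitDown_eq (by simp [hx.2]) (by simp [hy.2]) hxy
  have hdisj : ∀ a : Fin 2, ∀ x ∈ ({x | x j = a ∧ x i = 1} : Finset (Grid 2 d)),
      bitDown i 0 x ∉ ({x | x j = a ∧ x i = 1} : Finset (Grid 2 d)) := by
    intro a x hx
    simp only [mem_filter, mem_univ, true_and] at hx ⊢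
    rw [hdown x hx.2]
    simp
  refine farFromUnate_of_matching fun g hg => ?_
  rcases hg i with hmono | hanti
  · refine ⟨_, bitDown i 0, hinj 1, hdisj 1, fun x hx h₁ h₂ => ?_, hcard 1⟩
    simp only [mem_filter, mem_univ, true_and] at hx
    have hle := le_of_monotone_bitDown hmono 0 x
    rw [← h₁, ← h₂, hdown x hx.2, hj, hx.1, hx.2] at hle
    norm_num at hle
  · refine ⟨_, bitDown i 0, hinj 0, hdisj 0, fun x hx h₁ h₂ => ?_, hcard 0⟩
    simp only [mem_filter, mem_univ, true_and] at hx
    have hle := le_of_antitone_bitDown hanti 0 x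
    rw [← h₁, ← h₂, hdown x hx.2, hj, hx.1, hx.2] at hle
    norm_num at hle

/-- Without queries, a tester cannot distinguish a constant function from a parity. -/
theorem one_le_of_isUnatenessTester {d q : ℕ} (hd : 2 ≤ d) {ε : ℝ} (hε : ε ≤ 1 / 8) {Ω : Type*}
    [MeasurableSpace Ω] (μ : Measure Ω) [IsProbabilityMeasure μ]
    (T : NonadaptiveAlgorithm (Grid 2 d) Ω) (hT : T.IsUnatenessTester μ ε)
    (hTq : T.MakesAtMost q) : 1 ≤ q := by
  by_contra! hq
  have hij : (⟨1, by omega⟩ : Fin d) ≠ ⟨0, by omega⟩ := by simp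
  refine not_isUnatenessTester_of_indistinguishable (Z := Unit) (q := q) (fun _ _ => 0) _
    (fun _ _ => Or.inl fun _ => monotone_const)
    (fun _ => (farFromUnate_xor hij).mono hε) (fun Q hQ D => ?_) μ T hTq hT
  have hempty : Q = ∅ := card_eq_zero.1 (by omega)
  subst hempty
  have : IsEmpty {x : Grid 2 d // x ∈ (∅ : Finset (Grid 2 d))} :=
    ⟨fun x => notMem_empty _ x.2⟩
  simp only [Subsingleton.elim (_ : {x : Grid 2 d // x ∈ (∅ : Finset (Grid 2 d))} → ℝ) isEmptyElim]
  simp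

theorem mul_log_side_le {n d q : ℕ} (hn : 3 ≤ n) (hd : 1 ≤ d) {ε : ℝ} (hε : ε ≤ 1 / 8)
    {Ω : Type*} [MeasurableSpace Ω] (μ : Measure Ω) [IsProbabilityMeasure μ]
    (T : NonadaptiveAlgorithm (Grid n d) Ω) (hT : T.IsUnatenessTester μ ε)
    (hTq : T.MakesAtMost q) : (d : ℝ) * Real.log n ≤ 16 * q := by
  obtain ⟨L, hL, h₁, h₂⟩ : ∃ L, 1 ≤ L ∧ 2 ^ (L + 2) ≤ 3 * n ∧ 3 * n < 2 ^ (L + 3) := by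
    have h : 3 ≤ Nat.log 2 (3 * n) := Nat.le_log_of_pow_le (by norm_num) (by omega)
    refine ⟨Nat.log 2 (3 * n) - 2, by omega, ?_, ?_⟩
    · rw [Nat.sub_add_cancel (by omega)]
      exact Nat.pow_log_le_self 2 (by omega)
    · rw [show Nat.log 2 (3 * n) - 2 + 3 = Nat.log 2 (3 * n) + 1 by omega]
      exact Nat.lt_pow_succ_log_self (by norm_num) _
  have hlog : Real.log n ≤ 4 * L := by
    have h₃ : Real.log n ≤ Real.log ((2 : ℝ) ^ (L + 3)) :=
      Real.log_le_log (by exact_mod_cast (by omega : 0 < n))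
        (by exact_mod_cast (by omega : n ≤ 2 ^ (L + 3)))
    rw [Real.log_pow] at h₃
    have h₄ : Real.log 2 ≤ 1 := Real.log_two_lt_d9.le.trans (by norm_num)
    have h₅ : (1 : ℝ) ≤ L := by exact_mod_cast hL
    push_cast at h₃
    nlinarith
  have hq : ((d * L : ℕ) : ℝ) ≤ ((4 * q : ℕ) : ℝ) :=
    Nat.cast_le.2 (lt_four_mul_of_isUnatenessTester hd hL h₁ hε μ T hT hTq).le
  push_cast at hq
  have := mul_le_mul_of_nonneg_left hlog (Nat.cast_nonneg (α := ℝ) d)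
  linarith

theorem mul_log_dim_le {n d q : ℕ} (hn : 2 ≤ n) (hd : 16 ≤ d) {ε : ℝ} (hε : ε ≤ 1 / 8)
    {Ω : Type*} [MeasurableSpace Ω] (μ : Measure Ω) [IsProbabilityMeasure μ]
    (T : NonadaptiveAlgorithm (Grid n d) Ω) (hT : T.IsUnatenessTester μ ε)
    (hTq : T.MakesAtMost q) : (d : ℝ) * Real.log d ≤ 576 * q := by
  obtain ⟨K, D, t, hdD, hK, h₁, h₂, h₃, h₄⟩ : ∃ K D t, d = D + t ∧ 1 ≤ K ∧ 2 * (2 ^ K) ^ 2 ≤ D ∧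
      K + 2 ≤ t ∧ d ≤ 3 * D ∧ d < 4 ^ (K + 2) := by
    -- Half of the coordinates are used for selection; `K` is maximal with `2 * 4 ^ K ≤ D`.
    set K := Nat.log 4 (d / 2 / 2)
    have hK : 1 ≤ K := Nat.le_log_of_pow_le (by norm_num) (by omega)
    have hle : 4 ^ K ≤ d / 2 / 2 := Nat.pow_log_le_self 4 (by omega)
    have hlt : d / 2 / 2 < 4 ^ (K + 1) := Nat.lt_pow_succ_log_self (by norm_num) _
    have h4 : (2 ^ K) ^ 2 = 4 ^ K := by
      rw [← pow_mul, mul_comm, pow_mul]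
      norm_num
    have hKlt : K < 4 ^ K := Nat.lt_pow_self (by norm_num)
    refine ⟨K, d / 2, d - d / 2, by omega, hK, by omega, by omega, by omega, ?_⟩
    rw [pow_succ]
    omega
  have hlog : Real.log d ≤ 6 * K := by
    have h₅ : Real.log d ≤ Real.log ((2 : ℝ) ^ (2 * (K + 2))) := by
      refine Real.log_le_log (by exact_mod_cast (by omega : 0 < d)) ?_
      rw [pow_mul]
      exact_mod_cast h₄.le
    rw [Real.log_pow] at h₅
    have h₆ : Real.log 2 ≤ 1 := Real.log_two_lt_d9.le.trans (by norm_num)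
    have h₇ : (1 : ℝ) ≤ K := by exact_mod_cast hK
    push_cast at h₅
    nlinarith
  have hq : ((K * D : ℕ) : ℝ) ≤ ((32 * q : ℕ) : ℝ) := by
    subst hdD
    exact Nat.cast_le.2 (lt_mul_of_isUnatenessTester hn hK h₁ h₂ hε μ T hT hTq).le
  push_cast at hq
  have h₈ : (d : ℝ) ≤ 3 * D := by exact_mod_cast h₃
  calc (d : ℝ) * Real.log d ≤ (3 * D) * (6 * K) :=
        mul_le_mul h₈ hlog (Real.log_natCast_nonneg d) (by positivity)
    _ ≤ 576 * q := by linarith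

end UnatenessTesting

theorem mainTheorem6 :
    ∃ c : ℝ, 0 < c ∧
      ∀ n d : ℕ, 2 ≤ n → 1 ≤ d → (n, d) ≠ (2, 1) →
      ∀ ε : ℝ, 0 < ε → ε ≤ 1 / 8 →
      ∀ (Ω : Type*) [MeasurableSpace Ω] (μ : MeasureTheory.Measure Ω)
        [MeasureTheory.IsProbabilityMeasure μ]
        (T : UnatenessTesting.NonadaptiveAlgorithm (UnatenessTesting.Grid n d) Ω) (q : ℕ),
        T.IsUnatenessTester μ ε → T.MakesAtMost q →
          c * ((d : ℝ) * (Real.log n + Real.log d)) ≤ (q : ℝ) := by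
  refine ⟨1 / 1152, by norm_num, fun n d hn hd hnd ε _ hε Ω _ μ _ T q hT hTq => ?_⟩
  suffices h : (d : ℝ) * Real.log n + d * Real.log d ≤ 1152 * q by linarith
  have hd0 : (0 : ℝ) ≤ d := Nat.cast_nonneg d
  have hq0 : (0 : ℝ) ≤ q := Nat.cast_nonneg q
  have hlog_le : ∀ {a b : ℕ}, 0 < a → a ≤ b → Real.log a ≤ Real.log b := fun ha hab =>
    Real.log_le_log (by exact_mod_cast ha) (by exact_mod_cast hab)
  rcases hn.eq_or_lt with rfl | hn3
  · rcases le_or_gt 16 d with hd16 | hd16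
    · have h₁ := UnatenessTesting.mul_log_dim_le le_rfl hd16 hε μ T hT hTq
      have h₂ := mul_le_mul_of_nonneg_left (hlog_le two_pos (by omega : 2 ≤ d)) hd0
      linarith
    · have hd2 : 2 ≤ d := by
        by_contra hlt
        exact hnd (by rw [show d = 1 by omega])
      have hq : (1 : ℝ) ≤ q := by
        exact_mod_cast UnatenessTesting.one_le_of_isUnatenessTester hd2 hε μ T hT hTq
      have h₁ := mul_le_mul_of_nonneg_left (hlog_le two_pos hd2) hd0
      have h₂ : (d : ℝ) ≤ 16 := by exact_mod_cast hd16.le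
      have h₃ : Real.log d ≤ d := Real.log_le_self hd0
      have h₄ : (d : ℝ) * Real.log d ≤ 16 * 16 :=
        mul_le_mul h₂ (h₃.trans h₂) (Real.log_natCast_nonneg d) (by norm_num)
      linarith
  · have h₁ := UnatenessTesting.mul_log_side_le hn3 hd hε μ T hT hTq
    rcases le_or_gt 16 d with hd16 | hd16
    · have h₂ := UnatenessTesting.mul_log_dim_le hn hd16 hε μ T hT hTq
      linarith
    · -- For bounded `d`, the factor `log d` is absorbed by `log n`.
      have h₂ : Real.log d ≤ 4 * Real.log n := by
        have h₃ : (d : ℝ) ≤ (n : ℝ) ^ 4 := by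
          have : 2 ^ 4 ≤ n ^ 4 := Nat.pow_le_pow_left hn 4
          exact_mod_cast (by omega : d ≤ n ^ 4)
        have h₄ := Real.log_le_log (by exact_mod_cast hd) h₃
        rwa [Real.log_pow] at h₄
      have h₃ := mul_le_mul_of_nonneg_left h₂ hd0
      linarith
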